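/- Let $T,\alpha,\beta>0$. For $u\in L^2(0,T)$ let $\operatorname{TV}(u)=\|Du\|_M$ be the total variation norm of the distributional derivative on $(0,T)$ ($=\infty$ if it is not a finite Radon measure), $\mathrm{BV}(0,T)=\{u:\operatorname{TV}(u)<\infty\}$, $\|u\|_{\mathrm{BV}}=\|u\|_{L^1}+\operatorname{TV}(u)$, and $$\operatorname{TGV}(u)=\sup\Big\{\int_0^T u\,v''\,dx \;\Big|\; v\in C_c^\infty(0,T),\ \|v\|_C\le\beta,\ \|v'\|_C\le\alpha\Big\},$$ where $\|\cdot\|_C$ is the uniform norm on $(0,T)$. Let $J(u)=f(u)+\operatorname{TGV}(u)$ for $u\in\mathrm{BV}(0,T)$, where $f$ satisfies: * (A1) $f:L^2(0,T)\to\mathbb R$ is continuously Fréchet differentiable; * (A2) its gradient $\nabla f:L^2(0,T)\to L^2(0,T)$ is Lipschitz continuous with constant $L_f>0$; * (A3) $f(u)\ge -C_f$ for all $u\in L^2(0,T)$, for some $C_f>0$; * (A4) the sublevel sets $\{u\in \mathrm{BV}(0,T): J(u)\le b\}$, $b\in\mathbb R$, are bounded in $\mathrm{BV}(0,T)$. Let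 $\mathcal L$ be the space of affine linear functions on $(0,T)$, $S_x=1_{(x,T)}$, and $K_x(t)=1_{(0,x)}(t)\,(x-t)$ if $x<T/2$, $K_x(t)=1_{(x,T)}(t)\,(t-x)$ if $x\ge T/2$. Let $\mathcal E=\{\pm S_x/\alpha : x\in(0,T)\}\cup\{\pm K_x/\beta : x\in(\beta/\alpha,T-\beta/\alpha)\}$. For a finite set $\mathcal A\subset L^2(0,T)$ let $(\mathcal P(\mathcal A))$ be the problem of minimizing $f\big(\sum_{v\in\mathcal A}\lambda_v v+\ell\big)+\sum_{v\in\mathcal A}\lambda_v$ over $\lambda\in\mathbb R_{\ge0}^{\mathcal A}$, $\ell\in\mathcal L$. Consider the following algorithm. Start with a finite set $\mathcal A_0\subset\mathcal E$, take a minimizer $(\lambda^1,\ell^1)$ of $(\mathcal P(\mathcal A_0))$, set $u_1=\sum_{v\in\mathcal A_0}\lambda^1_v v+\ell^1$ and $\mathcal A_1=\{v\in\mathcal A_0:\lambda_v^1\neq0\}$. For $k=1,2,\dots$ let $p_k(x)=\int_0^x\nabla f(u_k)\,ds$, $P_k(x)=-\int_0^x p_k\,ds$, and choose $\hat x_k^S,\hat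 x_k^K\in(0,T)$ with $|p_k(\hat x^S_k)|=\|p_k\|_C$ and $|P_k(\hat x^K_k)|=\|P_k\|_C$. If $\|p_k\|_C\le\alpha$ and $\|P_k\|_C\le\beta$, stop. Otherwise let $$\widehat u_k=\begin{cases}\big(\operatorname{sign}(p_k(\hat x^S_k))/\alpha\big)\,S_{\hat x^S_k}&\text{if }\|p_k\|_C/\alpha\ge\|P_k\|_C/\beta,\\ \big(\operatorname{sign}(P_k(\hat x^K_k))/\beta\big)\,K_{\hat x^K_k}&\text{otherwise,}\end{cases}$$ set $\mathcal A_k^+=\mathcal A_k\cup\{\widehat u_k\}$, take a minimizer $(\lambda^{k+1},\ell^{k+1})$ of $(\mathcal P(\mathcal A_k^+))$, set $u_{k+1}=\sum_{v\in\mathcal A_k^+}\lambda^{k+1}_v v+\ell^{k+1}$ and $\mathcal A_{k+1}=\{v\in\mathcal A_k^+:\lambda^{k+1}_v\ne0\}$. Suppose that the algorithm does not stop after finitely many iterations. Put $M_0=f(0)+C_f$ and, for $k\ge1$, $$\Psi(u_k)=M_0\Big(\max\{\|p_k\|_C/\alpha,\ \|P_k\|_C/\beta\}-1\Big),\qquad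 \widehat r_J(u_k)=f(u_k)+\sum_{v\in\mathcal A_k}\lambda^k_v-\min_{u\in\mathrm{BV}(0,T)}J(u).$$ Let $C>0$ be such that $\max\{\|u_k\|_{L^2},\,M_0\|\widehat u_k\|_{L^2}\}\le C$ for all $k\ge1$. Then for all $k\ge1$ $$\min_{1\le j\le k}\Psi(u_j)+\min_{1\le j\le k}\Big|\sum_{v\in\mathcal A_j}\lambda^j_v-\operatorname{TGV}(u_j)\Big|\ \le\ \sqrt{\frac{8L_fC^2\,\widehat r_J(u_1)}{k}} .$$ In particular, the left-hand side is $\mathcal O(k^{-1/2})$ as $k\to\infty$. -/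

import Mathlib

namespace TGVMin

open MeasureTheory Set
open scoped ENNReal NNReal ContDiff

/-- The Hilbert space `L²(0,T)`. -/
abbrev L2 (T : ℝ) : Type := Lp ℝ 2 (volume.restrict (Ioo (0 : ℝ) T))

/-- The test functions `C_c^∞(0,T)`. -/
def IsTest (T : ℝ) (v : ℝ → ℝ) : Prop :=
  ContDiff ℝ ∞ v ∧ HasCompactSupport v ∧ tsupport v ⊆ Ioo 0 T

/-- `TV(u) = ‖Du‖_M`, the total mass of the distributional derivative of `u` on `(0,T)`
(it is `∞` if that derivative is not a finite Radon measure). -/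
noncomputable def tv (T : ℝ) (u : L2 T) : ℝ≥0∞ :=
  ⨆ φ ∈ {φ : ℝ → ℝ | IsTest T φ ∧ ∀ x, |φ x| ≤ 1},
    ENNReal.ofReal (∫ x in Ioo 0 T, u x * deriv φ x)

/-- `BV(0,T)`, as a subset of `L²(0,T)`; on a bounded interval every function of bounded
variation is essentially bounded, and every `L²` function is in `L¹`. -/
def BV (T : ℝ) : Set (L2 T) := {u | tv T u < ⊤}

/-- The norm `‖u‖_BV = ‖u‖_{L¹} + TV(u)`. -/
noncomputable def bvNorm (T : ℝ) (u : L2 T) : ℝ≥0∞ :=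
  eLpNorm u 1 (volume.restrict (Ioo (0 : ℝ) T)) + tv T u

/-- The second order total generalized variation, in its dual form. -/
noncomputable def tgv (T α β : ℝ) (u : L2 T) : ℝ≥0∞ :=
  ⨆ v ∈ {v : ℝ → ℝ | IsTest T v ∧ (∀ x, |v x| ≤ β) ∧ ∀ x, |deriv v x| ≤ α},
    ENNReal.ofReal (∫ x in Ioo 0 T, u x * deriv (deriv v) x)

/-- `TGV` is finite on `BV(0,T)`, so that its real value is meaningful there. -/
theorem tgv_ne_top {T α β : ℝ} (hα : 0 < α) {u : L2 T} (hu : u ∈ BV T) :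
    tgv T α β u ≠ ⊤ := by
  have key : tgv T α β u ≤ ENNReal.ofReal α * tv T u := by
    refine iSup₂_le fun v hv => ?_
    obtain ⟨⟨h1, h2, h3⟩, -, h4⟩ := hv
    have hd : ContDiff ℝ ∞ (deriv v) :=
      ((contDiff_infty_iff_deriv (𝕜 := ℝ)).1 h1).2
    have hφ : (fun x => α⁻¹ * deriv v x) ∈
        {φ : ℝ → ℝ | IsTest T φ ∧ ∀ x, |φ x| ≤ 1} := by
      refine ⟨⟨contDiff_const.mul hd, h2.deriv.mul_left, ?_⟩, fun x => ?_⟩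
      · refine (closure_mono ?_).trans ((tsupport_deriv_subset (𝕜 := ℝ) (f := v)).trans h3)
        intro x hx
        simp only [Function.mem_support] at hx ⊢
        exact right_ne_zero_of_mul hx
      · rw [abs_mul, abs_of_pos (inv_pos.2 hα), inv_mul_le_iff₀ hα, mul_one]
        exact h4 x
    have hle := le_iSup₂ (f := fun φ (_ : φ ∈ {φ : ℝ → ℝ | IsTest T φ ∧ ∀ x, |φ x| ≤ 1}) =>
      ENNReal.ofReal (∫ x in Ioo 0 T, u x * deriv φ x)) _ hφ
    have hEq : (∫ x in Ioo 0 T, u x * deriv (deriv v) x) =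
        α * ∫ x in Ioo 0 T, u x * deriv (fun x => α⁻¹ * deriv v x) x := by
      rw [← integral_const_mul]
      refine integral_congr_ae (Filter.Eventually.of_forall fun x => ?_)
      have hdx : deriv (fun x => α⁻¹ * deriv v x) x = α⁻¹ * deriv (deriv v) x :=
        deriv_const_mul_field _
      simp only [hdx]
      field_simp
    rw [hEq, ENNReal.ofReal_mul hα.le]
    exact mul_le_mul_right hle _
  exact ne_top_of_le_ne_top (ENNReal.mul_ne_top ENNReal.ofReal_ne_top (ne_of_lt hu)) key

/-- The objective `J(u) = f(u) + TGV(u)`, for `u ∈ BV(0,T)`. -/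
noncomputable def J (T α β : ℝ) (f : L2 T → ℝ) (u : L2 T) : ℝ :=
  f u + (tgv T α β u).toReal

/-- The space `𝓛` of affine linear functions. -/
def Aff (T : ℝ) : Set (L2 T) :=
  {l | ∃ c d : ℝ, l =ᵐ[volume.restrict (Ioo (0 : ℝ) T)] fun x => c * x + d}

/-- The jump function `S_x = 1_{(x,T)}`. -/
noncomputable def jumpFun (T x : ℝ) : ℝ → ℝ := (Ioo x T).indicator fun _ => 1

/-- The kink function `K_x`. -/
noncomputable def kinkFun (T x : ℝ) : ℝ → ℝ :=
  if x < T / 2 then (Ioo 0 x).indicator fun t => x - t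
  else (Ioo x T).indicator fun t => t - x

theorem memLp_jumpFun (T x : ℝ) :
    MemLp (jumpFun T x) 2 (volume.restrict (Ioo (0 : ℝ) T)) :=
  (memLp_const 1).indicator measurableSet_Ioo

theorem memLp_kinkFun (T x : ℝ) :
    MemLp (kinkFun T x) 2 (volume.restrict (Ioo (0 : ℝ) T)) := by
  have key : MemLp (fun t : ℝ => t - x) 2 (volume.restrict (Ioo (0 : ℝ) T)) := by
    refine MemLp.of_bound (by fun_prop) (|T| + |x|) ?_
    filter_upwards [ae_restrict_mem measurableSet_Ioo] with t ht
    rw [Real.norm_eq_abs]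
    refine (abs_sub _ _).trans (add_le_add ?_ le_rfl)
    rw [abs_of_pos ht.1]
    exact ht.2.le.trans (le_abs_self T)
  unfold kinkFun
  split_ifs
  · have h := key.neg.indicator (s := Ioo 0 x) measurableSet_Ioo
    refine h.congr_norm ?_ ?_
    · exact (Measurable.indicator (by fun_prop) measurableSet_Ioo).aestronglyMeasurable
    · refine Filter.Eventually.of_forall fun t => ?_
      simp [Set.indicator_apply]
  · exact key.indicator measurableSet_Ioo

/-- `S_x` as an element of `L²(0,T)`. -/
noncomputable def S (T x : ℝ) : L2 T := (memLp_jumpFun T x).toLp _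

/-- `K_x` as an element of `L²(0,T)`. -/
noncomputable def K (T x : ℝ) : L2 T := (memLp_kinkFun T x).toLp _

/-- `Ext B`: the functions `± S_x / α` with `x ∈ (0,T)`, and `± K_x / β` with
`x ∈ (β/α, T - β/α)`. -/
def ExtB (T α β : ℝ) : Set (L2 T) :=
  {u | ∃ x ∈ Ioo 0 T, ∃ σ : ℝ, (σ = 1 ∨ σ = -1) ∧ u = (σ / α) • S T x} ∪
  {u | ∃ x ∈ Ioo (β / α) (T - β / α), ∃ σ : ℝ, (σ = 1 ∨ σ = -1) ∧ u = (σ / β) • K T x}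

/-- The function `∑_{v ∈ A} λ_v v + ℓ`. Only the values of `lam` on `A` matter. -/
noncomputable def comb {T : ℝ} (A : Finset (L2 T)) (lam : L2 T → ℝ) (l : L2 T) : L2 T :=
  ∑ v ∈ A, lam v • v + l

/-- The objective `f(∑ λ_v v + ℓ) + ∑ λ_v` of the subproblem `P(A)`. -/
noncomputable def subObj {T : ℝ} (f : L2 T → ℝ) (A : Finset (L2 T)) (lam : L2 T → ℝ)
    (l : L2 T) : ℝ :=
  f (comb A lam l) + ∑ v ∈ A, lam v

/-- `(λ, ℓ)` is feasible for `P(A)`: `λ ≥ 0` on `A` and `ℓ ∈ 𝓛`. -/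
def Feasible {T : ℝ} (A : Finset (L2 T)) (lam : L2 T → ℝ) (l : L2 T) : Prop :=
  (∀ v ∈ A, 0 ≤ lam v) ∧ l ∈ Aff T

/-- `(λ, ℓ)` is a (global) minimizer of `P(A)`. -/
def IsSubMin {T : ℝ} (f : L2 T → ℝ) (A : Finset (L2 T)) (lam : L2 T → ℝ) (l : L2 T) : Prop :=
  Feasible A lam l ∧ ∀ lam' l', Feasible A lam' l' → subObj f A lam l ≤ subObj f A lam' l'

/-- The dual variable `p(x) = ∫_0^x ∇f(u)(s) ds`. -/
noncomputable def dualp {T : ℝ} (f : L2 T → ℝ) (u : L2 T) (x : ℝ) : ℝ :=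
  ∫ s in (0 : ℝ)..x, gradient f u s

/-- The dual variable `P(x) = -∫_0^x p(s) ds`. -/
noncomputable def dualP {T : ℝ} (f : L2 T → ℝ) (u : L2 T) (x : ℝ) : ℝ :=
  -∫ s in (0 : ℝ)..x, dualp f u s

/-- The uniform norm over `(0,T)`. -/
noncomputable def supNorm (T : ℝ) (q : ℝ → ℝ) : ℝ := sSup ((fun x => |q x|) '' Ioo 0 T)

/-- The new candidate built from the points `xS`, `xK`. -/
noncomputable def candidate {T : ℝ} (α β : ℝ) (f : L2 T → ℝ) (u : L2 T) (xS xK : ℝ) : L2 T :=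
  if supNorm T (dualP f u) / β ≤ supNorm T (dualp f u) / α then
    (Real.sign (dualp f u xS) / α) • S T xS
  else
    (Real.sign (dualP f u xK) / β) • K T xK

open Classical in
/-- An infinite (that is, never terminating) run of the algorithm. The iterates `u k`, their
weights `lam k` and affine parts `ell k` are those of iteration `k ≥ 1`; at index `0` only
the initial active set `A 0` is relevant. -/
structure Run (T α β : ℝ) (f : L2 T → ℝ) where
  /-- the active sets -/
  A : ℕ → Finset (L2 T)
  /-- the weights -/
  lam : ℕ → L2 T → ℝ
  /-- the affine parts -/
  ell : ℕ → L2 T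
  /-- the iterates -/
  u : ℕ → L2 T
  /-- a maximizer of `|p_k|` -/
  xS : ℕ → ℝ
  /-- a maximizer of `|P_k|` -/
  xK : ℕ → ℝ
  -- Input and zeroth iteration
  A_zero : ∀ v ∈ A 0, v ∈ ExtB T α β
  min_one : IsSubMin f (A 0) (lam 1) (ell 1)
  u_one : u 1 = comb (A 0) (lam 1) (ell 1)
  A_one : A 1 = (A 0).filter fun v => lam 1 v ≠ 0
  -- Maximizers of the dual variables
  xS_mem : ∀ k, 1 ≤ k → xS k ∈ Ioo 0 T
  xS_max : ∀ k, 1 ≤ k → |dualp f (u k) (xS k)| = supNorm T (dualp f (u k))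
  xK_mem : ∀ k, 1 ≤ k → xK k ∈ Ioo 0 T
  xK_max : ∀ k, 1 ≤ k → |dualP f (u k) (xK k)| = supNorm T (dualP f (u k))
  -- The stopping criterion is never met
  not_stopped : ∀ k, 1 ≤ k →
    ¬ (supNorm T (dualp f (u k)) ≤ α ∧ supNorm T (dualP f (u k)) ≤ β)
  -- Insertion, minimization over `P(A_k⁺)` with `A_k⁺ = A_k ∪ {û_k}`, and pruning
  min_succ : ∀ k, 1 ≤ k →
    IsSubMin f (insert (candidate α β f (u k) (xS k) (xK k)) (A k)) (lam (k + 1)) (ell (k + 1))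
  u_succ : ∀ k, 1 ≤ k →
    u (k + 1) =
      comb (insert (candidate α β f (u k) (xS k) (xK k)) (A k)) (lam (k + 1)) (ell (k + 1))
  A_succ : ∀ k, 1 ≤ k →
    A (k + 1) =
      (insert (candidate α β f (u k) (xS k) (xK k)) (A k)).filter fun v => lam (k + 1) v ≠ 0

namespace Run

variable {T α β : ℝ} {f : L2 T → ℝ}

/-- The candidate `û_k`. -/
noncomputable def uhat (R : Run T α β f) (k : ℕ) : L2 T :=
  candidate α β f (R.u k) (R.xS k) (R.xK k)

/-- The sum `∑_j λ_j^k` of the weights of the iterate `u_k` over the active set `A_k`. -/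
noncomputable def weight (R : Run T α β f) (k : ℕ) : ℝ := ∑ v ∈ R.A k, R.lam k v

/-- The constraint violation `Ψ(u_k) = M₀ (max {‖p_k‖_C/α, ‖P_k‖_C/β} - 1)`. -/
noncomputable def Psi (R : Run T α β f) (M₀ : ℝ) (k : ℕ) : ℝ :=
  M₀ * (max (supNorm T (dualp f (R.u k)) / α) (supNorm T (dualP f (R.u k)) / β) - 1)

/-- The gap `|∑_j λ_j^k - TGV(u_k)|`. -/
noncomputable def gap (R : Run T α β f) (k : ℕ) : ℝ :=
  |R.weight k - (tgv T α β (R.u k)).toReal|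

/-- The residual `f(u_k) + ∑_j λ_j^k - min_{BV(0,T)} J`. -/
noncomputable def residual (R : Run T α β f) (k : ℕ) : ℝ :=
  f (R.u k) + R.weight k - sInf (J T α β f '' BV T)

end Run

/-- The minimum of `g 1, …, g k` (for `k ≥ 1`). -/
noncomputable def minUpTo (g : ℕ → ℝ) (k : ℕ) : ℝ := sInf (g '' Icc 1 k)

theorem isLeast_minUpTo (g : ℕ → ℝ) {k : ℕ} (hk : 1 ≤ k) :
    IsLeast (g '' Icc 1 k) (minUpTo g k) :=
  ((finite_Icc 1 k).image g).isCompact.isLeast_sInf ((nonempty_Icc.2 hk).image g)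

end TGVMin

/-! Write m_k for `dualMax k` and W_k for the total weight of `u_k`. Two facts combine: the
violation Ψ(u_k) = M₀(m_k - 1) is square summable along the run, and it dominates the gap at every
iterate.

Optimality in the affine part makes ∇f(u_k) orthogonal to 𝓛. Its pairings with S_x and K_x are then
-p_k(x) and -P_k(x), so the candidate pairs with ∇f(u_k) to exactly -m_k (`inner_candidate`). Adding
û_k to u_k with weight sM₀ is feasible for the next subproblem, and the descent lemma bounds the
change of the objective by -sΨ + L_f C² s²/2. The best s gives Ψ² ≤ 2 L_f C² times the decrease of f
+ W (`Psi_sq_le`). Summation telescopes (`sum_Psi_sq_le`), so the smallest of the first k violations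
is at most √(2 L_f C² r₁/k), with r₁ the first residual.

For the gap, TGV(u_k) ≤ W_k holds because every atom has TGV at most one (`tgv_comb_le`).
Conversely, stationarity under scaling of the weights gives W_k = -⟨∇f(u_k), u_k⟩, and -∇f(u_k)/m_k
is a limit of admissible second derivatives up to vanishing factors, so W_k ≤ m_k TGV(u_k)
(`inner_neg_le_mul_tgv`). Since W_k ≤ M₀, the gap is at most Ψ(u_k). The left-hand side is thus at
most twice the minimal violation, which turns 2 into 8 under the root.

The analytic core is the duality step: second derivatives of test functions are dense in the
orthogonal complement of 𝓛, and L² closeness of v'' controls v and v' uniformly through pairings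
with kinks and jumps. -/

namespace TGVMin

open MeasureTheory Set
open scoped ENNReal NNReal ContDiff InnerProductSpace

/-! ### Test functions -/

section Test

variable {T : ℝ} {v φ : ℝ → ℝ}

theorem IsTest.differentiable (hv : IsTest T v) : Differentiable ℝ v :=
  hv.1.differentiable (by simp)

theorem IsTest.continuous (hv : IsTest T v) : Continuous v := hv.1.continuous

theorem IsTest.deriv (hv : IsTest T v) : IsTest T (deriv v) :=
  ⟨((contDiff_infty_iff_deriv (𝕜 := ℝ)).1 hv.1).2, hv.2.1.deriv,
    (tsupport_deriv_subset (𝕜 := ℝ) (f := v)).trans hv.2.2⟩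

theorem IsTest.eq_zero (hv : IsTest T v) {x : ℝ} (hx : x ∉ Ioo 0 T) : v x = 0 :=
  image_eq_zero_of_notMem_tsupport fun h => hx (hv.2.2 h)

theorem IsTest.const_mul (hv : IsTest T v) (c : ℝ) : IsTest T fun x => c * v x := by
  refine ⟨contDiff_const.mul hv.1, hv.2.1.mul_left, (closure_mono ?_).trans hv.2.2⟩
  intro x hx
  exact right_ne_zero_of_mul hx

theorem IsTest.add (hv : IsTest T v) (hφ : IsTest T φ) : IsTest T fun x => v x + φ x :=
  ⟨hv.1.add hφ.1, hv.2.1.add hφ.2.1,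
    (tsupport_add v φ).trans (union_subset hv.2.2 hφ.2.2)⟩

theorem IsTest.sub (hv : IsTest T v) (hφ : IsTest T φ) : IsTest T fun x => v x - φ x := by
  simpa [sub_eq_add_neg] using hv.add (hφ.const_mul (-1))

theorem isTest_zero : IsTest T fun _ => 0 :=
  ⟨contDiff_const, HasCompactSupport.zero, by simp [tsupport]⟩

theorem IsTest.integral_deriv (hv : IsTest T v) (a b : ℝ) :
    ∫ x in a..b, _root_.deriv v x = v b - v a :=
  intervalIntegral.integral_deriv_eq_sub (fun x _ => hv.differentiable x)
    (hv.deriv.continuous.intervalIntegrable a b)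

/-- A test function of mean zero has a primitive that is a test function. -/
theorem IsTest.exists_primitive (hφ : IsTest T φ) (h0 : ∫ x in 0..T, φ x = 0) :
    ∃ Φ, IsTest T Φ ∧ _root_.deriv Φ = φ := by
  have hd : ∀ x, HasDerivAt (fun x => ∫ t in 0..x, φ t) (φ x) x := fun x =>
    intervalIntegral.integral_hasDerivAt_right (hφ.continuous.intervalIntegrable _ _)
      hφ.continuous.stronglyMeasurable.stronglyMeasurableAtFilter hφ.continuous.continuousAt
  have hderiv : _root_.deriv (fun x => ∫ t in 0..x, φ t) = φ := funext fun x => (hd x).deriv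
  -- `φ` lives on a compact interval `[a, b] ⊆ (0, T)`
  obtain ⟨a, b, ha, hb, hab⟩ : ∃ a b, 0 < a ∧ b < T ∧ tsupport φ ⊆ Icc a b := by
    rcases (tsupport φ).eq_empty_or_nonempty with h | h
    -- Empty support: any endpoints with `0 < a` and `b < T` do, as `a ≤ b` is never used.
    · exact ⟨1, T - 1, one_pos, by linarith, by simp [h]⟩
    · have hc : IsCompact (tsupport φ) := hφ.2.1
      obtain ⟨a, ha⟩ := hc.exists_isLeast h
      obtain ⟨b, hb⟩ := hc.exists_isGreatest h
      exact ⟨a, b, (hφ.2.2 ha.1).1, (hφ.2.2 hb.1).2, fun x hx => ⟨ha.2 hx, hb.2 hx⟩⟩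
  have hz : ∀ x, x ∉ Icc a b → φ x = 0 := fun x hx =>
    image_eq_zero_of_notMem_tsupport fun h => hx (hab h)
  have hsupp : Function.support (fun x => ∫ t in 0..x, φ t) ⊆ Icc a b := by
    intro x hx
    by_contra hn
    refine hx ?_
    rcases lt_or_ge x a with hxa | hxa
    · refine intervalIntegral.integral_zero_ae (Filter.Eventually.of_forall fun t ht => hz t ?_)
      rintro ⟨h1, -⟩
      rcases le_max_iff.1 ht.2 with h | h <;> linarith
    · have hbx : b < x := not_le.1 fun h => hn ⟨hxa, h⟩
      -- Beyond `b` the primitive is the full integral, zero by assumption, plus a tail on which `φ`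
      -- vanishes.
      have h1 : (∫ t in 0..x, φ t) = (∫ t in 0..T, φ t) + ∫ t in T..x, φ t :=
        (intervalIntegral.integral_add_adjacent_intervals
          (hφ.continuous.intervalIntegrable _ _) (hφ.continuous.intervalIntegrable _ _)).symm
      simp only [h1, h0, zero_add]
      refine intervalIntegral.integral_zero_ae (Filter.Eventually.of_forall fun t ht => hz t ?_)
      rintro ⟨-, h2⟩
      rcases min_lt_iff.1 ht.1 with h | h <;> linarith
  have hts : tsupport (fun x => ∫ t in 0..x, φ t) ⊆ Icc a b :=
    closure_minimal hsupp isClosed_Icc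
  refine ⟨fun x => ∫ t in 0..x, φ t, ⟨?_, ?_, ?_⟩, hderiv⟩
  · rw [contDiff_infty_iff_deriv]
    exact ⟨fun x => (hd x).differentiableAt, by rw [hderiv]; exact hφ.1⟩
  · exact isCompact_Icc.of_isClosed_subset (isClosed_tsupport _) hts
  · exact hts.trans fun x hx => ⟨ha.trans_le hx.1, hx.2.trans_lt hb⟩

theorem exists_isTest_integral_eq_one (hT : 0 < T) :
    ∃ ρ, IsTest T ρ ∧ ∫ x in 0..T, ρ x = 1 := by
  have hm : Ioo 0 T ∈ nhds (T / 2) := Ioo_mem_nhds (by linarith) (by linarith)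
  obtain ⟨f, h1, h2, h3, h4, h5⟩ := exists_contDiff_tsupport_subset (n := (⊤ : ℕ∞)) hm
  have ht : IsTest T f := ⟨h3, h2, h1⟩
  have hpos : 0 < ∫ x in 0..T, f x := by
    refine intervalIntegral.integral_pos hT h3.continuous.continuousOn
      (fun x _ => (h4 ⟨x, rfl⟩).1) ⟨T / 2, ⟨by linarith, by linarith⟩, by simp [h5]⟩
  refine ⟨fun x => (∫ x in 0..T, f x)⁻¹ * f x, ht.const_mul _, ?_⟩
  rw [intervalIntegral.integral_const_mul, inv_mul_cancel₀ hpos.ne']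

end Test

/-! ### Primitives and the pairing with jumps and kinks -/

section Pairing

variable {T x : ℝ} {g : ℝ → ℝ}

/-- Integration by parts against x - t, whose boundary terms both vanish. Absolute continuity of the
primitive suffices, so `g` may be a mere L² gradient. -/
theorem integral_primitive (hg : IntervalIntegrable g volume 0 x) :
    ∫ s in 0..x, ∫ t in 0..s, g t = ∫ t in 0..x, (x - t) * g t := by
  have hP := hg.absolutelyContinuousOnInterval_intervalIntegral (c := 0) (by simp)
  have hq : AbsolutelyContinuousOnInterval (fun t => x - t) 0 x :=
    ContDiffOn.absolutelyContinuousOnInterval (by fun_prop)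
  have h := hq.integral_mul_deriv_eq_deriv_mul hP
  have hae : ∫ t in 0..x, (x - t) * deriv (fun s => ∫ t in 0..s, g t) t =
      ∫ t in 0..x, (x - t) * g t := by
    refine intervalIntegral.integral_congr_ae ?_
    filter_upwards [hg.ae_hasDerivAt_integral] with t ht hx
    rw [(ht (uIoc_subset_uIcc hx) 0 (by simp)).deriv]
  have hdq : ∀ t, deriv (fun t => x - t) t = -1 := fun t => by simp
  rw [hae] at h
  simp only [hdq] at h
  simp at h
  exact h.symm

theorem setIntegral_Ioo_eq (hT : 0 ≤ T) (h : ℝ → ℝ) :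
    ∫ t in Ioo 0 T, h t = ∫ t in 0..T, h t := by
  rw [intervalIntegral.integral_of_le hT, integral_Ioc_eq_integral_Ioo]

theorem integral_mul_jumpFun (hg : IntervalIntegrable g volume 0 T) (hx : x ∈ Ioo 0 T) :
    ∫ t in Ioo 0 T, g t * jumpFun T x t = (∫ t in 0..T, g t) - ∫ t in 0..x, g t := by
  have h0 : ∀ t, g t * jumpFun T x t = (Ioo x T).indicator g t := fun t => by
    by_cases h : t ∈ Ioo x T <;> simp [jumpFun, h]
  simp only [h0]
  rw [setIntegral_indicator measurableSet_Ioo,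
    inter_eq_self_of_subset_right (Ioo_subset_Ioo_left hx.1.le), ← integral_Ioc_eq_integral_Ioo,
    ← intervalIntegral.integral_of_le hx.2.le, intervalIntegral.integral_interval_sub_left hg]
  exact hg.mono_set (by
    rw [uIcc_of_le hx.1.le, uIcc_of_le (hx.1.trans hx.2).le]; exact Icc_subset_Icc_right hx.2.le)

/-- The two branches of K_x differ by the affine function x - t. Against a mean-zero `g` this costs
exactly the second primitive at `T`, which is the correction term. -/
theorem integral_mul_kinkFun (hg : IntervalIntegrable g volume 0 T)
    (h1 : ∫ t in 0..T, g t = 0) (hx : x ∈ Ioo 0 T) :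
    ∫ t in Ioo 0 T, g t * kinkFun T x t = (∫ s in 0..x, ∫ t in 0..s, g t) -
      if x < T / 2 then 0 else ∫ s in 0..T, ∫ t in 0..s, g t := by
  have hT : 0 < T := hx.1.trans hx.2
  have hg0 : IntervalIntegrable g volume 0 x := hg.mono_set (by
    rw [uIcc_of_le hx.1.le, uIcc_of_le hT.le]; exact Icc_subset_Icc_right hx.2.le)
  rw [integral_primitive hg0]
  unfold kinkFun
  split_ifs with hlt
  · have h0 : ∀ t, g t * (Ioo 0 x).indicator (fun t => x - t) t =
        (Ioo 0 x).indicator (fun t => (x - t) * g t) t := fun t => by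
      by_cases h : t ∈ Ioo 0 x <;> simp [h, mul_comm]
    simp only [h0]
    rw [setIntegral_indicator measurableSet_Ioo,
      inter_eq_self_of_subset_right (Ioo_subset_Ioo_right hx.2.le), setIntegral_Ioo_eq hx.1.le, sub_zero]
  · have h0 : ∀ t, g t * (Ioo x T).indicator (fun t => t - x) t =
        (Ioo x T).indicator (fun t => (t - x) * g t) t := fun t => by
      by_cases h : t ∈ Ioo x T <;> simp [h, mul_comm]
    have hi : IntervalIntegrable (fun t => (t - x) * g t) volume 0 T :=
      hg.continuousOn_mul (by fun_prop)
    have hi0 : IntervalIntegrable (fun t => (t - x) * g t) volume 0 x :=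
      hg0.continuousOn_mul (by fun_prop)
    simp only [h0]
    rw [setIntegral_indicator measurableSet_Ioo,
      inter_eq_self_of_subset_right (Ioo_subset_Ioo_left hx.1.le), ← integral_Ioc_eq_integral_Ioo,
      ← intervalIntegral.integral_of_le hx.2.le, ← intervalIntegral.integral_interval_sub_left hi hi0]
    have hz : ∫ t in 0..T, (t - x) * g t = -∫ s in 0..T, ∫ t in 0..s, g t := by
      have hsplit : ∀ t, (t - x) * g t = (T - x) * g t - (T - t) * g t := fun t => by ring
      simp only [hsplit]
      rw [intervalIntegral.integral_sub (hg.const_mul _) (hg.continuousOn_mul (by fun_prop)),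
        intervalIntegral.integral_const_mul, h1, ← integral_primitive hg]
      simp
    have hneg : ∫ t in 0..x, (t - x) * g t = -∫ t in 0..x, (x - t) * g t := by
      rw [← intervalIntegral.integral_neg]
      exact intervalIntegral.integral_congr fun t _ => by ring
    rw [hz, hneg]
    ring

end Pairing

/-! ### Continuous functions in `L²(0,T)` -/

theorem _root_.Continuous.memLp_restrict_Ioo {q : ℝ → ℝ} (hq : Continuous q) (a b : ℝ) :
    MemLp q 2 (volume.restrict (Ioo a b)) := by
  obtain ⟨B, hB⟩ := isCompact_Icc.exists_bound_of_continuousOn (s := Icc a b) hq.continuousOn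
  refine MemLp.of_bound hq.aestronglyMeasurable B ?_
  filter_upwards [ae_restrict_mem measurableSet_Ioo] with t ht using hB t (Ioo_subset_Icc_self ht)

/-- A continuous function as an element of `L²(0,T)`. -/
noncomputable def ofCont (T : ℝ) (q : ℝ → ℝ) (hq : Continuous q) : L2 T :=
  (hq.memLp_restrict_Ioo 0 T).toLp q

theorem ofCont_ae (T : ℝ) (q : ℝ → ℝ) (hq : Continuous q) :
    ofCont T q hq =ᵐ[volume.restrict (Ioo (0 : ℝ) T)] q := MemLp.coeFn_toLp _

theorem inner_eq_integral {T : ℝ} (u w : L2 T) : ⟪u, w⟫_ℝ = ∫ x in Ioo 0 T, u x * w x := by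
  rw [L2.inner_def]
  refine integral_congr_ae (Filter.Eventually.of_forall fun x => ?_)
  simp [mul_comm]

theorem inner_ofCont {T : ℝ} (u : L2 T) {q : ℝ → ℝ} (hq : Continuous q) :
    ⟪u, ofCont T q hq⟫_ℝ = ∫ x in Ioo 0 T, u x * q x := by
  rw [inner_eq_integral]
  refine integral_congr_ae ?_
  filter_upwards [ofCont_ae T q hq] with x hx
  rw [hx]

theorem inner_S {T : ℝ} (u : L2 T) (x : ℝ) :
    ⟪u, S T x⟫_ℝ = ∫ t in Ioo 0 T, u t * jumpFun T x t := by
  rw [inner_eq_integral]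
  refine integral_congr_ae ?_
  filter_upwards [(memLp_jumpFun T x).coeFn_toLp] with t ht
  rw [S, ht]

theorem inner_K {T : ℝ} (u : L2 T) (x : ℝ) :
    ⟪u, K T x⟫_ℝ = ∫ t in Ioo 0 T, u t * kinkFun T x t := by
  rw [inner_eq_integral]
  refine integral_congr_ae ?_
  filter_upwards [(memLp_kinkFun T x).coeFn_toLp] with t ht
  rw [K, ht]

theorem integral_ofCont_mul {T : ℝ} {q : ℝ → ℝ} (hq : Continuous q) (h : ℝ → ℝ) :
    ∫ t in Ioo 0 T, ofCont T q hq t * h t = ∫ t in Ioo 0 T, q t * h t := by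
  refine integral_congr_ae ?_
  filter_upwards [ofCont_ae T q hq] with x hx
  rw [hx]

theorem intervalIntegrable_L2 {T : ℝ} (hT : 0 ≤ T) (u : L2 T) :
    IntervalIntegrable u volume 0 T := by
  rw [intervalIntegrable_iff_integrableOn_Ioo_of_le hT]
  exact (Lp.memLp u).integrable one_le_two

theorem inner_deriv_S {T x : ℝ} {φ : ℝ → ℝ} (hφ : IsTest T φ) (hx : x ∈ Ioo 0 T) :
    ⟪ofCont T (deriv φ) hφ.deriv.continuous, S T x⟫_ℝ = -φ x := by
  rw [inner_S, integral_ofCont_mul,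
    integral_mul_jumpFun (hφ.deriv.continuous.intervalIntegrable _ _) hx, hφ.integral_deriv,
    hφ.integral_deriv, hφ.eq_zero (x := T) (by simp), hφ.eq_zero (x := 0) (by simp)]
  ring

theorem inner_deriv2_K {T x : ℝ} {v : ℝ → ℝ} (hv : IsTest T v) (hx : x ∈ Ioo 0 T) :
    ⟪ofCont T (deriv (deriv v)) hv.deriv.deriv.continuous, K T x⟫_ℝ = v x := by
  have hp : ∀ s, ∫ t in 0..s, deriv (deriv v) t = deriv v s := fun s => by
    rw [hv.deriv.integral_deriv, hv.deriv.eq_zero (x := 0) (by simp), sub_zero]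
  have hP : ∀ s, ∫ t in 0..s, deriv v t = v s := fun s => by
    rw [hv.integral_deriv, hv.eq_zero (x := 0) (by simp), sub_zero]
  rw [inner_K, integral_ofCont_mul,
    integral_mul_kinkFun (hv.deriv.deriv.continuous.intervalIntegrable _ _) _ hx]
  · simp [hp, hP, hv.eq_zero (x := T) (by simp)]
  · rw [hp, hv.deriv.eq_zero (by simp)]

/-! ### Affine functions -/

section Affine

variable {T : ℝ}

theorem inner_ae_eq {u w : L2 T} {h : ℝ → ℝ}
    (hw : w =ᵐ[volume.restrict (Ioo (0 : ℝ) T)] h) :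
    ⟪u, w⟫_ℝ = ∫ t in Ioo 0 T, u t * h t := by
  rw [inner_eq_integral]
  refine integral_congr_ae ?_
  filter_upwards [hw] with x hx
  rw [hx]

theorem ofCont_affine_mem_Aff (c d : ℝ) :
    ofCont T (fun x => c * x + d) (by fun_prop) ∈ Aff T :=
  ⟨c, d, ofCont_ae _ _ _⟩

theorem zero_mem_Aff : (0 : L2 T) ∈ Aff T :=
  ⟨0, 0, by filter_upwards [Lp.coeFn_zero ℝ 2 (volume.restrict (Ioo (0 : ℝ) T))] with x hx
            rw [hx]; simp⟩

theorem add_smul_mem_Aff {l l' : L2 T} (hl : l ∈ Aff T) (hl' : l' ∈ Aff T) (t : ℝ) :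
    l + t • l' ∈ Aff T := by
  obtain ⟨c, d, h⟩ := hl
  obtain ⟨c', d', h'⟩ := hl'
  refine ⟨c + t * c', d + t * d', ?_⟩
  filter_upwards [h, h', Lp.coeFn_add l (t • l'), Lp.coeFn_smul t l'] with x h1 h2 h3 h4
  rw [h3, Pi.add_apply, h4, Pi.smul_apply, h1, h2, smul_eq_mul]
  ring

/-- Since ct + d = (cT + d) - c(T - t), only the end values of the first two primitives enter. -/
theorem inner_affine (hT : 0 ≤ T) (w : L2 T) {l : L2 T} {c d : ℝ}
    (hl : l =ᵐ[volume.restrict (Ioo (0 : ℝ) T)] fun x => c * x + d) :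
    ⟪w, l⟫_ℝ = (c * T + d) * (∫ t in 0..T, w t) - c * ∫ s in 0..T, ∫ t in 0..s, w t := by
  have hw := intervalIntegrable_L2 hT w
  rw [inner_ae_eq hl, setIntegral_Ioo_eq hT, integral_primitive hw,
    ← intervalIntegral.integral_const_mul, ← intervalIntegral.integral_const_mul,
    ← intervalIntegral.integral_sub (hw.const_mul _)
      ((hw.continuousOn_mul (by fun_prop)).const_mul _)]
  exact intervalIntegral.integral_congr fun t _ => by ring

theorem ofCont_primitive {q : ℝ → ℝ} (hq : Continuous q) {x : ℝ} (hx : x ∈ Icc 0 T) :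
    ∫ t in 0..x, ofCont T q hq t = ∫ t in 0..x, q t := by
  have h := ofCont_ae T q hq
  rw [Filter.EventuallyEq, ae_restrict_iff' measurableSet_Ioo] at h
  rw [← setIntegral_Ioo_eq hx.1, ← setIntegral_Ioo_eq hx.1]
  refine setIntegral_congr_ae measurableSet_Ioo ?_
  filter_upwards [h] with t ht htx
  exact ht ⟨htx.1, htx.2.trans_le hx.2⟩

theorem ofCont_deriv_primitive {φ : ℝ → ℝ} (hφ : IsTest T φ) {x : ℝ}
    (hx : x ∈ Icc 0 T) :
    ∫ t in 0..x, ofCont T (deriv φ) hφ.deriv.continuous t = φ x := by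
  rw [ofCont_primitive _ hx, hφ.integral_deriv, hφ.eq_zero (x := 0) (by simp), sub_zero]

theorem ofCont_deriv_primitive2 {φ : ℝ → ℝ} (hφ : IsTest T φ) {x : ℝ}
    (hx : x ∈ Icc 0 T) :
    ∫ s in 0..x, ∫ t in 0..s, ofCont T (deriv φ) hφ.deriv.continuous t = ∫ s in 0..x, φ s := by
  refine intervalIntegral.integral_congr fun s hs => ?_
  rw [uIcc_of_le hx.1] at hs
  exact ofCont_deriv_primitive hφ ⟨hs.1, hs.2.trans hx.2⟩

theorem inner_deriv_affine (hT : 0 ≤ T) {φ : ℝ → ℝ} (hφ : IsTest T φ) {l : L2 T} {c d : ℝ}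
    (hl : l =ᵐ[volume.restrict (Ioo (0 : ℝ) T)] fun x => c * x + d) :
    ⟪ofCont T (deriv φ) hφ.deriv.continuous, l⟫_ℝ = -c * ∫ s in 0..T, φ s := by
  rw [inner_affine hT _ hl, ofCont_deriv_primitive hφ ⟨hT, le_rfl⟩,
    ofCont_deriv_primitive2 hφ ⟨hT, le_rfl⟩, hφ.eq_zero (x := T) (by simp)]
  ring

theorem inner_deriv2_affine (hT : 0 ≤ T) {v : ℝ → ℝ} (hv : IsTest T v) {l : L2 T}
    (hl : l ∈ Aff T) :
    ⟪ofCont T (deriv (deriv v)) hv.deriv.deriv.continuous, l⟫_ℝ = 0 := by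
  obtain ⟨c, d, hl⟩ := hl
  rw [inner_deriv_affine hT hv.deriv hl, hv.integral_deriv, hv.eq_zero (x := T) (by simp),
    hv.eq_zero (x := 0) (by simp)]
  ring

theorem primitive_eq_zero_of_orthogonal (hT : 0 ≤ T) {w : L2 T}
    (hw : ∀ l ∈ Aff T, ⟪w, l⟫_ℝ = 0) :
    (∫ t in 0..T, w t = 0) ∧ ∫ s in 0..T, ∫ t in 0..s, w t = 0 := by
  have h1 := hw _ (ofCont_affine_mem_Aff 0 1)
  -- The function t - T vanishes at `T`, which isolates the second primitive.
  have h2 := hw _ (ofCont_affine_mem_Aff 1 (-T))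
  rw [inner_affine hT w (ofCont_ae _ _ _)] at h1 h2
  constructor <;> linarith

theorem inner_S_of_orthogonal {w : L2 T} (hw : ∀ l ∈ Aff T, ⟪w, l⟫_ℝ = 0) {x : ℝ}
    (hx : x ∈ Ioo 0 T) : ⟪w, S T x⟫_ℝ = -∫ t in 0..x, w t := by
  have hT : 0 ≤ T := (hx.1.trans hx.2).le
  rw [inner_S, integral_mul_jumpFun (intervalIntegrable_L2 hT w) hx,
    (primitive_eq_zero_of_orthogonal hT hw).1, zero_sub]

/-- For `w` orthogonal to the affine functions, the pairing with `K_x` is the second primitive of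
`w` at `x`. -/
theorem inner_K_of_orthogonal {w : L2 T} (hw : ∀ l ∈ Aff T, ⟪w, l⟫_ℝ = 0) {x : ℝ}
    (hx : x ∈ Ioo 0 T) : ⟪w, K T x⟫_ℝ = ∫ s in 0..x, ∫ t in 0..s, w t := by
  have hT : 0 ≤ T := (hx.1.trans hx.2).le
  obtain ⟨h1, h2⟩ := primitive_eq_zero_of_orthogonal hT hw
  rw [inner_K, integral_mul_kinkFun (intervalIntegrable_L2 hT w) h1 hx, h2]
  simp

end Affine

/-! ### Density of second derivatives of test functions -/

section Density

variable {T : ℝ}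

/-- The second derivatives of test functions, as a subspace of `L²(0,T)`. -/
noncomputable def testDeriv2 (T : ℝ) : Submodule ℝ (L2 T) where
  carrier := {y | ∃ (v : ℝ → ℝ) (hv : IsTest T v),
    y = ofCont T (deriv (deriv v)) hv.deriv.deriv.continuous}
  zero_mem' := by
    refine ⟨_, isTest_zero (T := T), ?_⟩
    refine Lp.ext ?_
    filter_upwards [Lp.coeFn_zero ℝ 2 (volume.restrict (Ioo (0 : ℝ) T)),
      ofCont_ae T _ (isTest_zero (T := T)).deriv.deriv.continuous] with x h1 h2
    rw [h1, h2]
    simp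
  add_mem' := by
    rintro _ _ ⟨v, hv, rfl⟩ ⟨w, hw, rfl⟩
    refine ⟨_, hv.add hw, ?_⟩
    refine Lp.ext ?_
    filter_upwards [Lp.coeFn_add (ofCont T _ hv.deriv.deriv.continuous)
      (ofCont T _ hw.deriv.deriv.continuous), ofCont_ae T _ hv.deriv.deriv.continuous,
      ofCont_ae T _ hw.deriv.deriv.continuous,
      ofCont_ae T _ (hv.add hw).deriv.deriv.continuous] with x h1 h2 h3 h4
    have hd : deriv (fun x => v x + w x) = fun x => deriv v x + deriv w x :=
      funext fun x => deriv_fun_add (hv.differentiable x) (hw.differentiable x)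
    rw [h1, Pi.add_apply, h2, h3, h4, hd,
      deriv_fun_add (hv.deriv.differentiable x) (hw.deriv.differentiable x)]
  smul_mem' := by
    rintro c _ ⟨v, hv, rfl⟩
    refine ⟨_, hv.const_mul c, ?_⟩
    refine Lp.ext ?_
    filter_upwards [Lp.coeFn_smul c (ofCont T _ hv.deriv.deriv.continuous),
      ofCont_ae T _ hv.deriv.deriv.continuous,
      ofCont_ae T _ (hv.const_mul c).deriv.deriv.continuous] with x h1 h2 h3
    have hd : deriv (fun x => c * v x) = fun x => c * deriv v x :=
      funext fun x => deriv_const_mul_field _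
    rw [h1, Pi.smul_apply, h2, h3, hd, deriv_const_mul_field, smul_eq_mul]

/-- A function whose second distributional derivative vanishes is affine. -/
theorem mem_Aff_of_mem_orthogonal (hT : 0 < T) {h : L2 T} (hh : h ∈ (testDeriv2 T)ᗮ) :
    h ∈ Aff T := by
  obtain ⟨ρ, hρ, hρ1⟩ := exists_isTest_integral_eq_one hT
  have hint : ∀ q : ℝ → ℝ, Continuous q → IntervalIntegrable (fun t => h t * q t) volume 0 T :=
    fun q hq => (intervalIntegrable_L2 hT.le h).mul_continuousOn hq.continuousOn
  set c₁ : ℝ := ∫ t in 0..T, h t * ρ t with hc₁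
  set c₂ : ℝ := ∫ t in 0..T, h t * deriv ρ t with hc₂
  -- pairing with an arbitrary test function
  have hpair : ∀ φ, IsTest T φ → ∃ A B : ℝ, (∫ t in 0..T, h t * φ t = A * c₁ + B * c₂) ∧
      A = (∫ t in 0..T, φ t) ∧ B = ∫ t in 0..T, (T - t) * (φ t - A * ρ t) := by
    intro φ hφ
    -- Subtracting multiples of `ρ` restores mean zero before each of two integrations. This gives φ
    -- = v'' + Aρ + Bρ', and `h` annihilates v''.
    set A := ∫ t in 0..T, φ t with hA
    have hφ₁ := hφ.sub (hρ.const_mul A)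
    obtain ⟨Φ, hΦ, hΦd⟩ := hφ₁.exists_primitive (by
      rw [intervalIntegral.integral_sub (hφ.continuous.intervalIntegrable _ _)
        ((hρ.const_mul A).continuous.intervalIntegrable _ _),
        intervalIntegral.integral_const_mul, hρ1]
      simp [hA])
    set B := ∫ t in 0..T, Φ t with hB
    have hΦ₁ := hΦ.sub (hρ.const_mul B)
    obtain ⟨v, hv, hvd⟩ := hΦ₁.exists_primitive (by
      rw [intervalIntegral.integral_sub (hΦ.continuous.intervalIntegrable _ _)
        ((hρ.const_mul B).continuous.intervalIntegrable _ _),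
        intervalIntegral.integral_const_mul, hρ1]
      simp [hB])
    have hv2 : ∀ t, φ t = deriv (deriv v) t + A * ρ t + B * deriv ρ t := fun t => by
      have h1 : deriv (deriv v) t = deriv Φ t - B * deriv ρ t := by
        rw [hvd, deriv_fun_sub (hΦ.differentiable t) ((hρ.const_mul B).differentiable t),
          deriv_const_mul_field]
      rw [h1, hΦd]
      ring
    have h0 : ∫ t in 0..T, h t * deriv (deriv v) t = 0 := by
      rw [← setIntegral_Ioo_eq hT.le, ← inner_ofCont h hv.deriv.deriv.continuous]
      rw [real_inner_comm]
      exact (Submodule.mem_orthogonal _ _).1 hh _ ⟨v, hv, rfl⟩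
    refine ⟨A, B, ?_, rfl, ?_⟩
    · have : ∀ t, h t * φ t = h t * deriv (deriv v) t + A * (h t * ρ t) + B * (h t * deriv ρ t) :=
        fun t => by rw [hv2]; ring
      simp only [this]
      rw [intervalIntegral.integral_add, intervalIntegral.integral_add, h0,
        intervalIntegral.integral_const_mul, intervalIntegral.integral_const_mul]
      · ring
      · exact hint _ hv.deriv.deriv.continuous
      · exact (hint _ hρ.continuous).const_mul _
      · exact (hint _ hv.deriv.deriv.continuous).add ((hint _ hρ.continuous).const_mul _)
      · exact (hint _ hρ.deriv.continuous).const_mul _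
    · have hprim : ∀ s, ∫ t in 0..s, (φ t - A * ρ t) = Φ s := fun s => by
        rw [← hΦd, hΦ.integral_deriv, hΦ.eq_zero (x := 0) (by simp), sub_zero]
      rw [← integral_primitive (hφ₁.continuous.intervalIntegrable _ _)]
      simp only [hprim, hB]
  set m := ∫ t in 0..T, (T - t) * ρ t with hm
  -- With A = ∫φ and B = ∫(T - t)φ - Am, the pairing Ac₁ + Bc₂ is the integral of φ against c₁ - c₂m
  -- + c₂(T - t).
  refine ⟨-c₂, c₁ - c₂ * m + c₂ * T, ?_⟩
  rw [Filter.EventuallyEq, ae_restrict_iff' measurableSet_Ioo]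
  have hloc : LocallyIntegrableOn (fun t => h t - (-c₂ * t + (c₁ - c₂ * m + c₂ * T)))
      (Ioo 0 T) volume := by
    refine IntegrableOn.locallyIntegrableOn ?_
    rw [← intervalIntegrable_iff_integrableOn_Ioo_of_le hT.le]
    exact (intervalIntegrable_L2 hT.le h).sub
      (Continuous.intervalIntegrable (by fun_prop) _ _)
  have hae := isOpen_Ioo.ae_eq_zero_of_integral_contDiff_smul_eq_zero hloc ?_
  · filter_upwards [hae] with t ht hmem
    exact sub_eq_zero.1 (ht hmem)
  intro φ h1 h2 h3
  have hφ : IsTest T φ := ⟨h1, h2, h3⟩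
  obtain ⟨A, B, hAB, hA, hB⟩ := hpair φ hφ
  have hset : ∫ t, φ t • (h t - (-c₂ * t + (c₁ - c₂ * m + c₂ * T))) =
      ∫ t in Ioo 0 T, φ t • (h t - (-c₂ * t + (c₁ - c₂ * m + c₂ * T))) := by
    rw [setIntegral_eq_integral_of_forall_compl_eq_zero]
    intro t ht
    rw [hφ.eq_zero ht, zero_smul]
  rw [hset, setIntegral_Ioo_eq hT.le]
  have hsplit : ∀ t, φ t • (h t - (-c₂ * t + (c₁ - c₂ * m + c₂ * T))) =
      h t * φ t - (c₁ - c₂ * m) * φ t - c₂ * ((T - t) * φ t) := fun t => by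
    rw [smul_eq_mul]; ring
  have hB' : B = (∫ t in 0..T, (T - t) * φ t) - A * m := by
    rw [hB, hm, ← intervalIntegral.integral_const_mul, ← intervalIntegral.integral_sub]
    · exact intervalIntegral.integral_congr fun t _ => by ring
    · exact Continuous.intervalIntegrable (by have := hφ.continuous; fun_prop) _ _
    · exact Continuous.intervalIntegrable (by have := hρ.continuous; fun_prop) _ _
  simp only [hsplit]
  rw [intervalIntegral.integral_sub, intervalIntegral.integral_sub, hAB,
    intervalIntegral.integral_const_mul, intervalIntegral.integral_const_mul, ← hA, hB']
  · ring
  · exact hint _ hφ.continuous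
  · exact (hφ.continuous.intervalIntegrable _ _).const_mul _
  · exact (hint _ hφ.continuous).sub ((hφ.continuous.intervalIntegrable _ _).const_mul _)
  · exact Continuous.intervalIntegrable (by have := hφ.continuous; fun_prop) _ _

/-- The closure of a subspace is its double orthogonal complement, and the first complement consists
of affine functions. -/
theorem mem_closure_testDeriv2 (hT : 0 < T) {w : L2 T} (hw : ∀ l ∈ Aff T, ⟪w, l⟫_ℝ = 0) :
    w ∈ closure (testDeriv2 T : Set (L2 T)) := by
  rw [← Submodule.topologicalClosure_coe, SetLike.mem_coe,
    ← Submodule.orthogonal_orthogonal_eq_closure, Submodule.mem_orthogonal']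
  exact fun h hh => hw h (mem_Aff_of_mem_orthogonal hT hh)

end Density

/-! ### Functions of bounded variation and the total generalized variation -/

section Variation

variable {T α β : ℝ}

/-- The pairing of `u` with derivatives of test functions bounded by one is bounded. -/
def BddPairing (T : ℝ) (u : L2 T) : Prop :=
  ∃ B : ℝ, ∀ φ (hφ : IsTest T φ), (∀ x, |φ x| ≤ 1) →
    |⟪ofCont T (deriv φ) hφ.deriv.continuous, u⟫_ℝ| ≤ B

theorem BddPairing.mem_BV {u : L2 T} (hu : BddPairing T u) : u ∈ BV T := by
  obtain ⟨B, hB⟩ := hu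
  refine lt_of_le_of_lt (iSup₂_le fun φ hφ => ?_) (ENNReal.ofReal_lt_top (r := B))
  refine ENNReal.ofReal_le_ofReal ?_
  rw [← inner_ofCont u hφ.1.deriv.continuous, real_inner_comm]
  exact (le_abs_self _).trans (hB φ hφ.1 hφ.2)

theorem BddPairing.add {u w : L2 T} (hu : BddPairing T u) (hw : BddPairing T w) :
    BddPairing T (u + w) := by
  obtain ⟨B, hB⟩ := hu
  obtain ⟨B', hB'⟩ := hw
  refine ⟨B + B', fun φ hφ h => ?_⟩
  rw [inner_add_right]
  exact (abs_add_le _ _).trans (add_le_add (hB φ hφ h) (hB' φ hφ h))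

theorem BddPairing.smul {u : L2 T} (hu : BddPairing T u) (c : ℝ) : BddPairing T (c • u) := by
  obtain ⟨B, hB⟩ := hu
  refine ⟨|c| * B, fun φ hφ h => ?_⟩
  rw [real_inner_smul_right, abs_mul]
  exact mul_le_mul_of_nonneg_left (hB φ hφ h) (abs_nonneg c)

theorem bddPairing_zero : BddPairing T 0 := ⟨0, fun φ hφ _ => by simp⟩

theorem bddPairing_sum {A : Finset (L2 T)} (hA : ∀ v ∈ A, BddPairing T v) (lam : L2 T → ℝ) :
    BddPairing T (∑ v ∈ A, lam v • v) :=
  Finset.sum_induction _ _ (fun _ _ => BddPairing.add) bddPairing_zero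
    fun v hv => (hA v hv).smul _

theorem abs_integral_le_of_abs_le_one {φ : ℝ → ℝ} (h : ∀ x, |φ x| ≤ 1) {x : ℝ}
    (hx : x ∈ Icc 0 T) : |∫ s in 0..x, φ s| ≤ T := by
  have := intervalIntegral.norm_integral_le_of_norm_le_const (a := 0) (b := x) (f := φ) (C := 1)
    fun t _ => h t
  rw [Real.norm_eq_abs, one_mul, sub_zero, abs_of_nonneg hx.1] at this
  exact this.trans hx.2

theorem bddPairing_of_mem_Aff (hT : 0 ≤ T) {l : L2 T} (hl : l ∈ Aff T) : BddPairing T l := by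
  obtain ⟨c, d, hl⟩ := hl
  refine ⟨|c| * T, fun φ hφ h => ?_⟩
  rw [inner_deriv_affine hT hφ hl, abs_mul, abs_neg]
  exact mul_le_mul_of_nonneg_left (abs_integral_le_of_abs_le_one h ⟨hT, le_rfl⟩) (abs_nonneg c)

theorem bddPairing_S {x : ℝ} (hx : x ∈ Ioo 0 T) : BddPairing T (S T x) := by
  refine ⟨1, fun φ hφ h => ?_⟩
  rw [inner_deriv_S hφ hx, abs_neg]
  exact h x

theorem bddPairing_K {x : ℝ} (hx : x ∈ Ioo 0 T) : BddPairing T (K T x) := by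
  have hT : 0 ≤ T := (hx.1.trans hx.2).le
  refine ⟨T + T, fun φ hφ h => ?_⟩
  have hp : ∀ s, ∫ t in 0..s, deriv φ t = φ s := fun s => by
    rw [hφ.integral_deriv, hφ.eq_zero (x := 0) (by simp), sub_zero]
  rw [inner_K, integral_ofCont_mul,
    integral_mul_kinkFun (hφ.deriv.continuous.intervalIntegrable _ _)
      (by rw [hp, hφ.eq_zero (by simp)]) hx]
  simp only [hp]
  refine (abs_sub _ _).trans (add_le_add
    (abs_integral_le_of_abs_le_one h (Ioo_subset_Icc_self hx)) ?_)
  split_ifs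
  · simpa using hT
  · exact abs_integral_le_of_abs_le_one h ⟨hT, le_rfl⟩

/-- The scaled jumps and kinks with arbitrary position in `(0,T)` and coefficient in `[-1,1]`. -/
def IsAtom (T α β : ℝ) (a : L2 T) : Prop :=
  ∃ x ∈ Ioo 0 T, ∃ σ : ℝ, |σ| ≤ 1 ∧ (a = (σ / α) • S T x ∨ a = (σ / β) • K T x)

theorem isAtom_of_mem_ExtB (hα : 0 < α) (hβ : 0 < β) {a : L2 T} (ha : a ∈ ExtB T α β) :
    IsAtom T α β a := by
  have hσ : ∀ σ : ℝ, σ = 1 ∨ σ = -1 → |σ| ≤ 1 := by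
    rintro σ (rfl | rfl) <;> simp
  have hpos := div_pos hβ hα
  rcases ha with ⟨x, hx, σ, h, rfl⟩ | ⟨x, hx, σ, h, rfl⟩
  · exact ⟨x, hx, σ, hσ σ h, Or.inl rfl⟩
  · exact ⟨x, ⟨hpos.trans hx.1, by linarith [hx.2]⟩, σ, hσ σ h, Or.inr rfl⟩

theorem abs_sign_le_one (r : ℝ) : |Real.sign r| ≤ 1 := by
  rcases Real.sign_apply_eq r with h | h | h <;> simp [h]

theorem isAtom_candidate {f : L2 T → ℝ} {u : L2 T} {xS xK : ℝ} (hS : xS ∈ Ioo 0 T)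
    (hK : xK ∈ Ioo 0 T) : IsAtom T α β (candidate α β f u xS xK) := by
  unfold candidate
  split_ifs
  · exact ⟨xS, hS, _, abs_sign_le_one _, Or.inl rfl⟩
  · exact ⟨xK, hK, _, abs_sign_le_one _, Or.inr rfl⟩

theorem IsAtom.bddPairing {a : L2 T} (ha : IsAtom T α β a) : BddPairing T a := by
  obtain ⟨x, hx, σ, -, rfl | rfl⟩ := ha
  · exact (bddPairing_S hx).smul _
  · exact (bddPairing_K hx).smul _

theorem div_mul_le_one {σ y c : ℝ} (hc : 0 < c) (hσ : |σ| ≤ 1) (hy : |y| ≤ c) :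
    σ / c * y ≤ 1 := by
  rw [div_mul_eq_mul_div, div_le_one hc]
  refine (le_abs_self _).trans ?_
  rw [abs_mul]
  calc |σ| * |y| ≤ 1 * c := mul_le_mul hσ hy (abs_nonneg _) zero_le_one
    _ = c := one_mul c

/-- Pairing v'' with a jump or a kink evaluates -v' or v at its position, so the two uniform bounds
suffice. The kink may therefore sit anywhere in (0,T), and the coefficient may be zero. -/
theorem IsAtom.inner_le_one (hα : 0 < α) (hβ : 0 < β) {a : L2 T} (ha : IsAtom T α β a)
    {v : ℝ → ℝ} (hv : IsTest T v) (h0 : ∀ x, |v x| ≤ β) (h1 : ∀ x, |deriv v x| ≤ α) :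
    ⟪ofCont T (deriv (deriv v)) hv.deriv.deriv.continuous, a⟫_ℝ ≤ 1 := by
  obtain ⟨x, hx, σ, hσ, rfl | rfl⟩ := ha
  · rw [real_inner_smul_right, inner_deriv_S hv.deriv hx]
    exact div_mul_le_one hα hσ (by rw [abs_neg]; exact h1 x)
  · rw [real_inner_smul_right, inner_deriv2_K hv hx]
    exact div_mul_le_one hβ hσ (h0 x)

theorem comb_mem_BV (hT : 0 ≤ T) {A : Finset (L2 T)} (hA : ∀ a ∈ A, IsAtom T α β a)
    (lam : L2 T → ℝ) {l : L2 T} (hl : l ∈ Aff T) : comb A lam l ∈ BV T :=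
  ((bddPairing_sum (fun a ha => (hA a ha).bddPairing) lam).add
    (bddPairing_of_mem_Aff hT hl)).mem_BV

/-- The weights of a conic combination of atoms bound its total generalized variation. -/
theorem tgv_comb_le (hT : 0 ≤ T) (hα : 0 < α) (hβ : 0 < β) {A : Finset (L2 T)}
    (hA : ∀ a ∈ A, IsAtom T α β a) {lam : L2 T → ℝ} {l : L2 T} (h : Feasible A lam l) :
    (tgv T α β (comb A lam l)).toReal ≤ ∑ v ∈ A, lam v := by
  refine ENNReal.toReal_le_of_le_ofReal (Finset.sum_nonneg h.1) (iSup₂_le fun v hv => ?_)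
  obtain ⟨hv, h0, h1⟩ := hv
  refine ENNReal.ofReal_le_ofReal ?_
  rw [← inner_ofCont _ hv.deriv.deriv.continuous, real_inner_comm, comb, inner_add_right,
    inner_deriv2_affine hT hv h.2, add_zero, inner_sum]
  refine Finset.sum_le_sum fun a ha => ?_
  rw [real_inner_smul_right]
  exact mul_le_of_le_one_right (h.1 a ha) ((hA a ha).inner_le_one hα hβ hv h0 h1)

/-- Uniformity in `x` is the point: it converts an L² error in a second derivative into uniform
errors in the function and its first derivative. -/
theorem exists_norm_S_le_norm_K_le (T : ℝ) :
    ∃ B : ℝ, 0 ≤ B ∧ ∀ x ∈ Ioo 0 T, ‖S T x‖ ≤ B ∧ ‖K T x‖ ≤ B := by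
  set c : ℝ := (measureUnivNNReal (volume.restrict (Ioo (0 : ℝ) T)) : ℝ) ^ (2 : ℝ≥0∞).toReal⁻¹
  have hc : 0 ≤ c := by positivity
  refine ⟨c * max 1 T, mul_nonneg hc (by positivity), fun x hx => ⟨?_, ?_⟩⟩
  · refine Lp.norm_le_of_ae_bound (by positivity) ?_
    filter_upwards [(memLp_jumpFun T x).coeFn_toLp] with t ht
    rw [S, ht, jumpFun, Set.indicator_apply]
    split_ifs <;> simp
  · refine Lp.norm_le_of_ae_bound (by positivity) ?_
    filter_upwards [(memLp_kinkFun T x).coeFn_toLp] with t ht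
    rw [K, ht, kinkFun]
    refine le_trans ?_ (le_max_right 1 T)
    have hT : 0 ≤ T := (hx.1.trans hx.2).le
    split_ifs
    · rw [Set.indicator_apply]
      split_ifs with h
      · rw [Real.norm_eq_abs, abs_of_pos (by linarith [h.2])]; linarith [h.1, hx.2]
      · simpa using hT
    · rw [Set.indicator_apply]
      split_ifs with h
      · rw [Real.norm_eq_abs, abs_of_pos (by linarith [h.1])]; linarith [h.2, hx.1]
      · simpa using hT

/-- Duality: a function orthogonal to the affine functions whose first and second primitives are
bounded by `m α` and `m β` pairs with `u` to at most `m TGV(u)`. -/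
theorem inner_neg_le_mul_tgv (hT : 0 < T) (hα : 0 < α) (hβ : 0 < β) {u w : L2 T}
    (hu : u ∈ BV T) (hw : ∀ l ∈ Aff T, ⟪w, l⟫_ℝ = 0) {m : ℝ} (hm : 0 < m)
    (h1 : ∀ x ∈ Ioo 0 T, |∫ t in 0..x, w t| ≤ m * α)
    (h2 : ∀ x ∈ Ioo 0 T, |∫ s in 0..x, ∫ t in 0..s, w t| ≤ m * β) :
    -⟪w, u⟫_ℝ ≤ m * (tgv T α β u).toReal := by
  obtain ⟨B, hB0, hB⟩ := exists_norm_S_le_norm_K_le T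
  -- Chosen so that `B ≤ c * r` for both `r = α` and `r = β`.
  set c := B / min α β with hc
  have hαβ : 0 < min α β := lt_min hα hβ
  have hc0 : 0 ≤ c := div_nonneg hB0 hαβ.le
  have hcB : B = c * min α β := by rw [hc, div_mul_cancel₀ _ hαβ.ne']
  -- The inequality is relaxed by an error term that makes it provable for every second derivative
  -- `y` of a test function. It is closed in `y`, and at `y = -w` the error vanishes.
  have hclosed : IsClosed {y : L2 T | ⟪y, u⟫_ℝ ≤ (m + c * ‖y + w‖) * (tgv T α β u).toReal} :=
    isClosed_le (by fun_prop) (by fun_prop)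
  have hsub : (testDeriv2 T : Set (L2 T)) ⊆
      {y : L2 T | ⟪y, u⟫_ℝ ≤ (m + c * ‖y + w‖) * (tgv T α β u).toReal} := by
    rintro _ ⟨v, hv, rfl⟩
    set y := ofCont T (deriv (deriv v)) hv.deriv.deriv.continuous with hy
    set M := m + c * ‖y + w‖ with hM
    have hM0 : 0 < M := add_pos_of_pos_of_nonneg hm (mul_nonneg hc0 (norm_nonneg _))
    -- Replacing `-w` by `y` costs at most ‖y + w‖‖z‖. Applied to z = K_x and z = S_x, this bounds
    -- `v` and its derivative, so v/M is admissible.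
    have hbound : ∀ z : L2 T, ‖z‖ ≤ B → ∀ r : ℝ, min α β ≤ r → |⟪w, z⟫_ℝ| ≤ m * r →
        |⟪y, z⟫_ℝ| ≤ M * r := by
      intro z hz r hr hwz
      have he : ⟪y, z⟫_ℝ = ⟪y + w, z⟫_ℝ - ⟪w, z⟫_ℝ := by rw [inner_add_left]; ring
      have hcs : |⟪y + w, z⟫_ℝ| ≤ ‖y + w‖ * (c * r) :=
        (abs_real_inner_le_norm _ _).trans (mul_le_mul_of_nonneg_left
          (hz.trans (hcB.le.trans (mul_le_mul_of_nonneg_left hr hc0))) (norm_nonneg _))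
      rw [he]
      refine (abs_sub _ _).trans ((add_le_add hcs hwz).trans_eq ?_)
      rw [hM]; ring
    have hv0 : ∀ x, |v x| ≤ M * β := by
      intro x
      by_cases hx : x ∈ Ioo 0 T
      · rw [← inner_deriv2_K hv hx]
        refine hbound _ (hB x hx).2 β (min_le_right _ _) ?_
        rw [inner_K_of_orthogonal hw hx]
        exact h2 x hx
      · rw [hv.eq_zero hx, abs_zero]; positivity
    have hv1 : ∀ x, |deriv v x| ≤ M * α := by
      intro x
      by_cases hx : x ∈ Ioo 0 T
      · rw [← abs_neg, ← inner_deriv_S hv.deriv hx]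
        refine hbound _ (hB x hx).1 α (min_le_left _ _) ?_
        rw [inner_S_of_orthogonal hw hx, abs_neg]
        exact h1 x hx
      · rw [hv.deriv.eq_zero hx, abs_zero]; positivity
    have hd1 : deriv (fun x => M⁻¹ * v x) = fun x => M⁻¹ * deriv v x :=
      funext fun x => deriv_const_mul_field _
    have hd2 : deriv (deriv fun x => M⁻¹ * v x) = fun x => M⁻¹ * deriv (deriv v) x := by
      rw [hd1]; exact funext fun x => deriv_const_mul_field _
    have hadm : (fun x => M⁻¹ * v x) ∈
        {v : ℝ → ℝ | IsTest T v ∧ (∀ x, |v x| ≤ β) ∧ ∀ x, |deriv v x| ≤ α} := by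
      refine ⟨hv.const_mul _, fun x => ?_, fun x => ?_⟩
      · rw [abs_mul, abs_of_pos (inv_pos.2 hM0), inv_mul_le_iff₀ hM0]
        exact hv0 x
      · rw [hd1, abs_mul, abs_of_pos (inv_pos.2 hM0), inv_mul_le_iff₀ hM0]
        exact hv1 x
    have hle : ENNReal.ofReal (∫ x in Ioo 0 T, u x * deriv (deriv fun x => M⁻¹ * v x) x) ≤
        tgv T α β u :=
      le_iSup₂ (f := fun v (_ : v ∈ {v : ℝ → ℝ | IsTest T v ∧ (∀ x, |v x| ≤ β) ∧
        ∀ x, |deriv v x| ≤ α}) => ENNReal.ofReal (∫ x in Ioo 0 T, u x * deriv (deriv v) x)) _ hadm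
    rw [ENNReal.ofReal_le_iff_le_toReal (tgv_ne_top hα hu), hd2] at hle
    have hI : ∫ x in Ioo 0 T, u x * (M⁻¹ * deriv (deriv v) x) = M⁻¹ * ⟪y, u⟫_ℝ := by
      rw [real_inner_comm, hy, inner_ofCont, ← integral_const_mul]
      exact integral_congr_ae (Filter.Eventually.of_forall fun x => by ring_nf)
    rw [hI, inv_mul_le_iff₀ hM0] at hle
    exact hle
  have hmem := closure_minimal hsub hclosed
    (mem_closure_testDeriv2 hT (w := -w) fun l hl => by rw [inner_neg_left, hw l hl, neg_zero])
  simpa using hmem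

end Variation

/-! ### Smooth functions with Lipschitz gradient -/

section Gradient

variable {H : Type*} [NormedAddCommGroup H] [InnerProductSpace ℝ H] [CompleteSpace H] {f : H → ℝ}

theorem hasDerivAt_comp_line (hf : Differentiable ℝ f) (u d : H) (t : ℝ) :
    HasDerivAt (fun t : ℝ => f (u + t • d)) ⟪gradient f (u + t • d), d⟫_ℝ t := by
  have h1 := (hf (u + t • d)).hasGradientAt.hasFDerivAt
  have h2 : HasDerivAt (fun t : ℝ => u + t • d) d t := by
    simpa using ((hasDerivAt_id t).smul_const d).const_add u
  have h3 := h1.comp_hasDerivAt t h2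
  rwa [InnerProductSpace.toDual_apply_apply] at h3

/-- The descent lemma. -/
theorem le_add_inner_gradient (hf : Differentiable ℝ f) {L : ℝ}
    (hL : ∀ u v : H, ‖gradient f u - gradient f v‖ ≤ L * ‖u - v‖) (u d : H) :
    f (u + d) ≤ f u + ⟪gradient f u, d⟫_ℝ + L / 2 * ‖d‖ ^ 2 := by
  -- The Lipschitz bound makes this function antitone on [0,1]; comparing its end values is the
  -- claim.
  set F : ℝ → ℝ := fun t => f (u + t • d) - t * ⟪gradient f u, d⟫_ℝ - t ^ 2 * (L / 2 * ‖d‖ ^ 2)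
    with hF
  have hd : ∀ t, HasDerivAt F (⟪gradient f (u + t • d), d⟫_ℝ - ⟪gradient f u, d⟫_ℝ -
      2 * t * (L / 2 * ‖d‖ ^ 2)) t := fun t => by
    have h2 : HasDerivAt (fun t : ℝ => t * ⟪gradient f u, d⟫_ℝ) ⟪gradient f u, d⟫_ℝ t := by
      simpa using (hasDerivAt_id t).mul_const ⟪gradient f u, d⟫_ℝ
    have h3 : HasDerivAt (fun t : ℝ => t ^ 2 * (L / 2 * ‖d‖ ^ 2)) (2 * t * (L / 2 * ‖d‖ ^ 2)) t := by
      simpa using (hasDerivAt_pow 2 t).mul_const (L / 2 * ‖d‖ ^ 2)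
    exact ((hasDerivAt_comp_line hf u d t).sub h2).sub h3
  have hanti : AntitoneOn F (Icc 0 1) := by
    refine antitoneOn_of_deriv_nonpos (convex_Icc 0 1)
      (fun t _ => (hd t).continuousAt.continuousWithinAt)
      (fun t _ => (hd t).differentiableAt.differentiableWithinAt) fun t ht => ?_
    rw [interior_Icc] at ht
    rw [(hd t).deriv, ← inner_sub_left]
    have h1 : ‖gradient f (u + t • d) - gradient f u‖ ≤ L * (t * ‖d‖) := by
      have := hL (u + t • d) u
      rwa [add_sub_cancel_left, norm_smul, Real.norm_eq_abs, abs_of_pos ht.1] at this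
    have h2 := (real_inner_le_norm (gradient f (u + t • d) - gradient f u) d).trans
      (mul_le_mul_of_nonneg_right h1 (norm_nonneg d))
    linarith
  have h := hanti (left_mem_Icc.2 zero_le_one) (right_mem_Icc.2 zero_le_one) zero_le_one
  simp only [hF, one_smul, zero_smul, add_zero] at h
  linarith

end Gradient

/-! ### The subproblems -/

section Subproblem

variable {T α β : ℝ} {f : L2 T → ℝ} {A : Finset (L2 T)} {lam : L2 T → ℝ} {l : L2 T}

theorem IsSubMin.le_zero (h : IsSubMin f A lam l) : subObj f A lam l ≤ f 0 := by
  simpa [subObj, comb] using h.2 (fun _ => 0) 0 ⟨fun _ _ => le_rfl, zero_mem_Aff⟩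

/-- The affine part is unconstrained in sign, so moves along `l'` are feasible in both directions
and the derivative vanishes. -/
theorem IsSubMin.inner_affine_eq_zero (hf : Differentiable ℝ f) (h : IsSubMin f A lam l)
    {l' : L2 T} (hl' : l' ∈ Aff T) : ⟪gradient f (comb A lam l), l'⟫_ℝ = 0 := by
  have hmin : IsLocalMin (fun t : ℝ => f (comb A lam l + t • l')) 0 := by
    refine Filter.Eventually.of_forall fun t => ?_
    have := h.2 lam (l + t • l') ⟨h.1.1, add_smul_mem_Aff h.1.2 hl' t⟩
    have hc : comb A lam (l + t • l') = comb A lam l + t • l' := by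
      simp only [comb, add_assoc]
    simp only [subObj, hc] at this
    simpa using this
  simpa using hmin.hasDerivAt_eq_zero (hasDerivAt_comp_line hf _ l' 0)

/-- Stationarity under scaling of the weights. -/
theorem IsSubMin.inner_eq_neg_sum (hf : Differentiable ℝ f) (h : IsSubMin f A lam l) :
    ⟪gradient f (comb A lam l), comb A lam l⟫_ℝ = -∑ v ∈ A, lam v := by
  set d := ∑ v ∈ A, lam v • v with hd
  have hmin : IsLocalMin (fun t : ℝ => f (comb A lam l + t • d) + t * ∑ v ∈ A, lam v) 0 := by
    -- Scaling the weights by 1 + t stays feasible on both sides of t = 0, hence an equality rather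
    -- than an inequality.
    filter_upwards [Ioi_mem_nhds (show (-1 : ℝ) < 0 by norm_num)] with t ht
    have ht' : 0 ≤ 1 + t := by linarith [mem_Ioi.1 ht]
    have := h.2 (fun v => (1 + t) * lam v) l ⟨fun v hv => mul_nonneg ht' (h.1.1 v hv), h.1.2⟩
    have hc : comb A (fun v => (1 + t) * lam v) l = comb A lam l + t • d := by
      simp only [comb, mul_smul]
      rw [← Finset.smul_sum, ← hd, add_smul, one_smul]
      abel
    simp only [subObj, hc, ← Finset.mul_sum] at this
    simp only [zero_smul, add_zero, zero_mul]
    linarith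
  have hder := (hasDerivAt_comp_line hf (comb A lam l) d 0).add
    ((hasDerivAt_id (0 : ℝ)).mul_const (∑ v ∈ A, lam v))
  have h0 := hmin.hasDerivAt_eq_zero hder
  have hl := h.inner_affine_eq_zero hf h.1.2
  have hc : comb A lam l = d + l := rfl
  simp only [zero_smul, add_zero, one_mul] at h0
  rw [show ⟪gradient f (comb A lam l), comb A lam l⟫_ℝ =
    ⟪gradient f (comb A lam l), d + l⟫_ℝ from rfl, inner_add_right, hl]
  linarith

open Classical in
/-- Shifting the weight of one atom. -/
theorem exists_feasible_insert (hA : Feasible A lam l) (a : L2 T) {s : ℝ} (hs : 0 ≤ s) :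
    ∃ lam', Feasible (insert a A) lam' l ∧ comb (insert a A) lam' l = comb A lam l + s • a ∧
      ∑ v ∈ insert a A, lam' v = (∑ v ∈ A, lam v) + s := by
  have h1 : ∀ {M : Type} [AddCommMonoid M] (F : L2 T → M),
      ∑ v ∈ insert a A, (if v ∈ A then F v else 0) = ∑ v ∈ A, F v := fun F => by
    rw [← Finset.sum_filter]
    congr 1
    ext v
    simp only [Finset.mem_filter, Finset.mem_insert]
    tauto
  -- The guard `v ∈ A` discards the meaningless value of `lam` at `a` when `a ∉ A`; if `a ∈ A`, the
  -- two weights add up.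
  refine ⟨fun v => (if v ∈ A then lam v else 0) + if v = a then s else 0,
    ⟨fun v _ => ?_, hA.2⟩, ?_, ?_⟩
  · refine add_nonneg ?_ ?_ <;> split_ifs with h
    exacts [hA.1 v h, le_rfl, hs, le_rfl]
  · have h2 := h1 fun v => lam v • v
    simp only [comb, add_smul, Finset.sum_add_distrib, ite_smul, zero_smul, h2,
      Finset.sum_ite_eq', Finset.mem_insert_self, if_true]
    abel
  · have h2 := h1 lam
    simp only [Finset.sum_add_distrib, h2, Finset.sum_ite_eq', Finset.mem_insert_self, if_true]

open Classical in
theorem comb_filter (A : Finset (L2 T)) (lam : L2 T → ℝ) (l : L2 T) :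
    comb (A.filter fun v => lam v ≠ 0) lam l = comb A lam l := by
  unfold comb
  rw [Finset.sum_filter_of_ne]
  intro v _ h h0
  exact h (by rw [h0, zero_smul])

open Classical in
theorem sum_filter_weights (A : Finset (L2 T)) (lam : L2 T → ℝ) :
    ∑ v ∈ A.filter (fun v => lam v ≠ 0), lam v = ∑ v ∈ A, lam v :=
  Finset.sum_filter_ne_zero A

end Subproblem

/-! ### The uniform norm of the dual variables -/

section SupNorm

variable {T α β : ℝ} {f : L2 T → ℝ}

theorem abs_le_supNorm {q : ℝ → ℝ} (hq : ContinuousOn q (Icc 0 T)) {x : ℝ} (hx : x ∈ Ioo 0 T) :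
    |q x| ≤ supNorm T q := by
  refine le_csSup ?_ ⟨x, hx, rfl⟩
  exact (isCompact_Icc.image_of_continuousOn hq.abs).bddAbove.mono
    (image_mono Ioo_subset_Icc_self)

theorem continuousOn_dualp (hT : 0 ≤ T) (u : L2 T) : ContinuousOn (dualp f u) (Icc 0 T) := by
  have h := intervalIntegral.continuousOn_primitive_interval' (a := 0)
    (intervalIntegrable_L2 hT (gradient f u)) (by simp)
  rwa [uIcc_of_le hT] at h

theorem continuousOn_dualP (hT : 0 ≤ T) (u : L2 T) : ContinuousOn (dualP f u) (Icc 0 T) := by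
  have hi : IntervalIntegrable (dualp f u) volume 0 T :=
    ContinuousOn.intervalIntegrable_of_Icc hT (continuousOn_dualp hT u)
  have h := intervalIntegral.continuousOn_primitive_interval' (a := 0) hi (by simp)
  rw [uIcc_of_le hT] at h
  exact h.neg

theorem sign_mul_self_eq_abs (r : ℝ) : Real.sign r * r = |r| := by
  rcases lt_trichotomy r 0 with h | h | h
  · rw [Real.sign_of_neg h, abs_of_neg h]; ring
  · simp [h]
  · rw [Real.sign_of_pos h, abs_of_pos h]; ring

/-- The candidate attains the largest scaled dual value. -/
theorem inner_candidate {u : L2 T} (hu : ∀ l ∈ Aff T, ⟪gradient f u, l⟫_ℝ = 0) {xS xK : ℝ}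
    (hS : xS ∈ Ioo 0 T) (hSmax : |dualp f u xS| = supNorm T (dualp f u))
    (hK : xK ∈ Ioo 0 T) (hKmax : |dualP f u xK| = supNorm T (dualP f u)) :
    ⟪gradient f u, candidate α β f u xS xK⟫_ℝ =
      -max (supNorm T (dualp f u) / α) (supNorm T (dualP f u) / β) := by
  unfold candidate
  split_ifs with h
  · have h1 : ⟪gradient f u, S T xS⟫_ℝ = -dualp f u xS := inner_S_of_orthogonal hu hS
    rw [max_eq_left h, real_inner_smul_right, h1, ← hSmax, ← sign_mul_self_eq_abs]
    ring
  · have h1 : ⟪gradient f u, K T xK⟫_ℝ = -dualP f u xK := by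
      rw [inner_K_of_orthogonal hu hK, dualP, neg_neg]; rfl
    rw [max_eq_right (not_le.1 h).le, real_inner_smul_right, h1, ← hKmax, ← sign_mul_self_eq_abs]
    ring

end SupNorm

/-! ### Runs of the algorithm -/

namespace Run

open Classical in
/-- The active set over which the iterate `u_k` minimizes: `A_0` for `k ≤ 1` and `A_{k-1}^+`
afterwards. -/
noncomputable def extended {T α β : ℝ} {f : L2 T → ℝ} (R : Run T α β f) : ℕ → Finset (L2 T)
  | 0 => R.A 0
  | 1 => R.A 0
  | k + 2 => insert (R.uhat (k + 1)) (R.A (k + 1))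

variable {T α β : ℝ} {f : L2 T → ℝ} (R : Run T α β f)

/-- The largest scaled dual value `max {‖p_k‖_C/α, ‖P_k‖_C/β}`. -/
noncomputable def dualMax (k : ℕ) : ℝ :=
  max (supNorm T (dualp f (R.u k)) / α) (supNorm T (dualP f (R.u k)) / β)

theorem isSubMin_extended {k : ℕ} (hk : 1 ≤ k) :
    IsSubMin f (R.extended k) (R.lam k) (R.ell k) := by
  match k, hk with
  | 1, _ => exact R.min_one
  | k + 2, _ => exact R.min_succ (k + 1) (by omega)

theorem u_eq_comb {k : ℕ} (hk : 1 ≤ k) : R.u k = comb (R.extended k) (R.lam k) (R.ell k) := by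
  match k, hk with
  | 1, _ => exact R.u_one
  | k + 2, _ => exact R.u_succ (k + 1) (by omega)

open Classical in
theorem A_eq_filter {k : ℕ} (hk : 1 ≤ k) :
    R.A k = (R.extended k).filter fun v => R.lam k v ≠ 0 := by
  match k, hk with
  | 1, _ => exact R.A_one
  | k + 2, _ => exact R.A_succ (k + 1) (by omega)

theorem weight_eq {k : ℕ} (hk : 1 ≤ k) : R.weight k = ∑ v ∈ R.extended k, R.lam k v := by
  classical
  rw [weight, R.A_eq_filter hk, ← sum_filter_weights (R.extended k) (R.lam k)]

theorem subObj_extended {k : ℕ} (hk : 1 ≤ k) :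
    subObj f (R.extended k) (R.lam k) (R.ell k) = f (R.u k) + R.weight k := by
  rw [subObj, ← R.u_eq_comb hk, R.weight_eq hk]

theorem u_eq_comb_A {k : ℕ} (hk : 1 ≤ k) : R.u k = comb (R.A k) (R.lam k) (R.ell k) := by
  classical
  rw [R.A_eq_filter hk, R.u_eq_comb hk, ← comb_filter (R.extended k)]

theorem feasible_A {k : ℕ} (hk : 1 ≤ k) : Feasible (R.A k) (R.lam k) (R.ell k) := by
  classical
  have h := (R.isSubMin_extended hk).1
  refine ⟨fun v hv => h.1 v ?_, h.2⟩
  rw [R.A_eq_filter hk] at hv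
  exact Finset.mem_of_mem_filter v hv

theorem isAtom_uhat {k : ℕ} (hk : 1 ≤ k) : IsAtom T α β (R.uhat k) :=
  isAtom_candidate (R.xS_mem k hk) (R.xK_mem k hk)

theorem isAtom_of_mem (hα : 0 < α) (hβ : 0 < β) (k : ℕ) : ∀ a ∈ R.A k, IsAtom T α β a := by
  classical
  induction k with
  | zero => exact fun a ha => isAtom_of_mem_ExtB hα hβ (R.A_zero a ha)
  | succ k ih =>
    intro a ha
    rw [R.A_eq_filter (by omega)] at ha
    have ha' := Finset.mem_of_mem_filter a ha
    -- `A 1` is pruned from `A 0` without an insertion; later sets may also contain a candidate.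
    match k with
    | 0 => exact ih a ha'
    | k + 1 =>
      rcases Finset.mem_insert.1 ha' with rfl | h
      · exact R.isAtom_uhat (by omega)
      · exact ih a h

variable {R}

theorem inner_affine_eq_zero (hf : Differentiable ℝ f) {k : ℕ} (hk : 1 ≤ k) :
    ∀ l ∈ Aff T, ⟪gradient f (R.u k), l⟫_ℝ = 0 := fun l hl => by
  rw [R.u_eq_comb hk]
  exact (R.isSubMin_extended hk).inner_affine_eq_zero hf hl

theorem inner_u_eq_neg_weight (hf : Differentiable ℝ f) {k : ℕ} (hk : 1 ≤ k) :
    ⟪gradient f (R.u k), R.u k⟫_ℝ = -R.weight k := by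
  rw [R.u_eq_comb hk, R.weight_eq hk]
  exact (R.isSubMin_extended hk).inner_eq_neg_sum hf

theorem u_mem_BV (hT : 0 < T) (hα : 0 < α) (hβ : 0 < β) {k : ℕ} (hk : 1 ≤ k) : R.u k ∈ BV T := by
  rw [R.u_eq_comb_A hk]
  exact comb_mem_BV hT.le (R.isAtom_of_mem hα hβ k) _ (R.feasible_A hk).2

theorem tgv_le_weight (hT : 0 < T) (hα : 0 < α) (hβ : 0 < β) {k : ℕ} (hk : 1 ≤ k) :
    (tgv T α β (R.u k)).toReal ≤ R.weight k := by
  rw [R.u_eq_comb_A hk]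
  exact tgv_comb_le hT.le hα hβ (R.isAtom_of_mem hα hβ k) (R.feasible_A hk)

theorem one_lt_dualMax (hα : 0 < α) (hβ : 0 < β) {k : ℕ} (hk : 1 ≤ k) : 1 < R.dualMax k := by
  by_contra! h
  obtain ⟨h1, h2⟩ := max_le_iff.1 h
  exact R.not_stopped k hk ⟨(div_le_one hα).1 h1, (div_le_one hβ).1 h2⟩

/-- Stationarity turns the weight into -⟨∇f(u_k), u_k⟩, and `dualMax` is precisely the factor
bounding |p_k| by α and |P_k| by β in the duality estimate. -/
theorem weight_le_dualMax_mul_tgv (hT : 0 < T) (hα : 0 < α) (hβ : 0 < β)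
    (hf : Differentiable ℝ f) {k : ℕ} (hk : 1 ≤ k) :
    R.weight k ≤ R.dualMax k * (tgv T α β (R.u k)).toReal := by
  have hm := zero_lt_one.trans (one_lt_dualMax (R := R) hα hβ hk)
  rw [← neg_neg (R.weight k), ← inner_u_eq_neg_weight hf hk]
  refine inner_neg_le_mul_tgv hT hα hβ (u_mem_BV hT hα hβ hk) (inner_affine_eq_zero hf hk) hm
    (fun x hx => ?_) fun x hx => ?_
  · exact (abs_le_supNorm (continuousOn_dualp hT.le (R.u k)) hx).trans
      ((div_le_iff₀ hα).1 (le_max_left _ _))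
  · have h := (abs_le_supNorm (continuousOn_dualP (f := f) hT.le (R.u k)) hx).trans
      ((div_le_iff₀ hβ).1 (le_max_right (supNorm T (dualp f (R.u k)) / α) _))
    rwa [dualP, abs_neg] at h

/-- The zero function is a competitor in every subproblem. -/
theorem weight_le {Cf : ℝ} (hf3 : ∀ u, -Cf ≤ f u) {k : ℕ} (hk : 1 ≤ k) : R.weight k ≤ f 0 + Cf := by
  have h := (R.isSubMin_extended hk).le_zero
  rw [R.subObj_extended hk] at h
  linarith [hf3 (R.u k)]

/-- The gap is at most the constraint violation. -/
theorem gap_le_Psi (hT : 0 < T) (hα : 0 < α) (hβ : 0 < β) (hf : Differentiable ℝ f) {Cf : ℝ}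
    (hf3 : ∀ u, -Cf ≤ f u) {k : ℕ} (hk : 1 ≤ k) : R.gap k ≤ R.Psi (f 0 + Cf) k := by
  have h1 := tgv_le_weight (R := R) hT hα hβ hk
  have h2 := weight_le_dualMax_mul_tgv (R := R) hT hα hβ hf hk
  have h3 := weight_le (R := R) hf3 hk
  have hm := one_lt_dualMax (R := R) hα hβ hk
  rw [gap, abs_of_nonneg (by linarith)]
  change _ ≤ (f 0 + Cf) * (R.dualMax k - 1)
  -- The gap is at most (dualMax - 1) TGV, and TGV is at most the weight, hence at most M₀.
  have h4 : (tgv T α β (R.u k)).toReal * (R.dualMax k - 1) ≤ (f 0 + Cf) * (R.dualMax k - 1) :=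
    mul_le_mul_of_nonneg_right (h1.trans h3) (by linarith)
  linarith

/-- Sufficient decrease. -/
theorem Psi_sq_le (hα : 0 < α) (hβ : 0 < β) (hf : Differentiable ℝ f) {L : ℝ} (hL : 0 < L)
    (hLip : ∀ u v : L2 T, ‖gradient f u - gradient f v‖ ≤ L * ‖u - v‖) {M₀ C : ℝ} (hM : 0 ≤ M₀)
    (hC : 0 < C) {k : ℕ} (hk : 1 ≤ k) (hbd : M₀ * ‖R.uhat k‖ ≤ C) :
    R.Psi M₀ k ^ 2 ≤ 2 * L * C ^ 2 *
      ((f (R.u k) + R.weight k) - (f (R.u (k + 1)) + R.weight (k + 1))) := by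
  classical
  have hPsi : 0 ≤ R.Psi M₀ k :=
    mul_nonneg hM (sub_nonneg.2 (one_lt_dualMax (R := R) hα hβ hk).le)
  -- Minimizer of -sΨ + LC²s²/2. The weights range over a cone, so no cap s ≤ 1 is required.
  set s := R.Psi M₀ k / (L * C ^ 2) with hs
  have hLC : 0 < L * C ^ 2 := by positivity
  have hs0 : 0 ≤ s := div_nonneg hPsi hLC.le
  obtain ⟨lam', hfeas, hcomb, hsum⟩ :=
    exists_feasible_insert (R.feasible_A hk) (R.uhat k) (mul_nonneg hs0 hM)
  have hmin := (R.min_succ k hk).2 lam' (R.ell k) (by convert! hfeas)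
  have hobj : subObj f (insert (R.uhat k) (R.A k)) (R.lam (k + 1)) (R.ell (k + 1)) =
      f (R.u (k + 1)) + R.weight (k + 1) := by
    -- `extended (k + 1)` unfolds to the enlarged set only once `k` is visibly a successor.
    obtain ⟨j, rfl⟩ : ∃ j, k = j + 1 := ⟨k - 1, by omega⟩
    exact R.subObj_extended (by omega)
  have hmin' : f (R.u (k + 1)) + R.weight (k + 1) ≤
      f (R.u k + (s * M₀) • R.uhat k) + (R.weight k + s * M₀) := by
    rw [← hobj, R.u_eq_comb_A hk, ← hcomb, weight, ← hsum]
    exact hmin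
  have hdesc := le_add_inner_gradient hf hLip (R.u k) ((s * M₀) • R.uhat k)
  have hinner : ⟪gradient f (R.u k), R.uhat k⟫_ℝ = -R.dualMax k :=
    inner_candidate (inner_affine_eq_zero hf hk) (R.xS_mem k hk) (R.xS_max k hk) (R.xK_mem k hk)
      (R.xK_max k hk)
  have hnorm : ‖(s * M₀) • R.uhat k‖ ^ 2 ≤ (s * C) ^ 2 := by
    rw [norm_smul, Real.norm_eq_abs, abs_of_nonneg (mul_nonneg hs0 hM), mul_assoc]
    exact pow_le_pow_left₀ (by positivity) (mul_le_mul_of_nonneg_left hbd hs0) 2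
  rw [real_inner_smul_right, hinner] at hdesc
  have hP : R.Psi M₀ k = M₀ * (R.dualMax k - 1) := rfl
  have hsL : s * (L * C ^ 2) = R.Psi M₀ k := div_mul_cancel₀ _ hLC.ne'
  have h1 : L / 2 * ‖(s * M₀) • R.uhat k‖ ^ 2 ≤ L / 2 * (s * C) ^ 2 :=
    mul_le_mul_of_nonneg_left hnorm (by positivity)
  have h2 : L / 2 * (s * C) ^ 2 = s * R.Psi M₀ k / 2 := by rw [← hsL]; ring
  have h3 : s * R.Psi M₀ k / 2 ≤
      (f (R.u k) + R.weight k) - (f (R.u (k + 1)) + R.weight (k + 1)) := by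
    have h4 : s * M₀ * -R.dualMax k + s * M₀ = -(s * R.Psi M₀ k) := by rw [hP]; ring
    linarith
  calc R.Psi M₀ k ^ 2 = 2 * L * C ^ 2 * (s * R.Psi M₀ k / 2) := by
        rw [sq]; nth_rewrite 1 [← hsL]; ring
    _ ≤ _ := mul_le_mul_of_nonneg_left h3 (by positivity)

/-- The weight dominates TGV, so the surrogate objective dominates J(u_k). The lower bound on `f`
makes the `sInf` a genuine infimum. -/
theorem residual_nonneg (hT : 0 < T) (hα : 0 < α) (hβ : 0 < β) {Cf : ℝ}
    (hf3 : ∀ u, -Cf ≤ f u) {k : ℕ} (hk : 1 ≤ k) : 0 ≤ R.residual k := by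
  have hbdd : BddBelow (J T α β f '' BV T) := by
    refine ⟨-Cf, ?_⟩
    rintro _ ⟨u, -, rfl⟩
    exact (hf3 u).trans (le_add_of_nonneg_right ENNReal.toReal_nonneg)
  have h := csInf_le hbdd ⟨R.u k, u_mem_BV hT hα hβ hk, rfl⟩
  have h1 := tgv_le_weight (R := R) hT hα hβ hk
  rw [J] at h
  rw [residual]
  linarith

/-- The sufficient decrease telescopes, and the last residual is dropped by its sign. -/
theorem sum_Psi_sq_le (hT : 0 < T) (hα : 0 < α) (hβ : 0 < β) (hf : Differentiable ℝ f) {L : ℝ}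
    (hL : 0 < L) (hLip : ∀ u v : L2 T, ‖gradient f u - gradient f v‖ ≤ L * ‖u - v‖) {Cf C : ℝ}
    (hf3 : ∀ u, -Cf ≤ f u) (hC : 0 < C) (hbd : ∀ k, 1 ≤ k → (f 0 + Cf) * ‖R.uhat k‖ ≤ C)
    (k : ℕ) : ∑ j ∈ Finset.range k, R.Psi (f 0 + Cf) (j + 1) ^ 2 ≤
      2 * L * C ^ 2 * R.residual 1 := by
  have hM : 0 ≤ f 0 + Cf := by linarith [hf3 0]
  have hres : ∀ j, R.residual (j + 1) - R.residual (j + 2) =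
      (f (R.u (j + 1)) + R.weight (j + 1)) - (f (R.u (j + 2)) + R.weight (j + 2)) := fun j => by
    rw [residual, residual]; ring
  calc ∑ j ∈ Finset.range k, R.Psi (f 0 + Cf) (j + 1) ^ 2
      ≤ ∑ j ∈ Finset.range k, 2 * L * C ^ 2 * (R.residual (j + 1) - R.residual (j + 2)) :=
        Finset.sum_le_sum fun j _ => by
          rw [hres]
          exact Psi_sq_le hα hβ hf hL hLip hM hC (by omega) (hbd _ (by omega))
    _ = 2 * L * C ^ 2 * (R.residual 1 - R.residual (k + 1)) := by
        rw [← Finset.mul_sum, Finset.sum_range_sub' (fun j => R.residual (j + 1))]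
    _ ≤ 2 * L * C ^ 2 * R.residual 1 :=
        mul_le_mul_of_nonneg_left
          (sub_le_self _ (residual_nonneg hT hα hβ hf3 (by omega))) (by positivity)

end Run

theorem minUpTo_le (g : ℕ → ℝ) {j k : ℕ} (hj : 1 ≤ j) (hjk : j ≤ k) : minUpTo g k ≤ g j :=
  (isLeast_minUpTo g (hj.trans hjk)).2 ⟨j, ⟨hj, hjk⟩, rfl⟩

theorem le_minUpTo {g : ℕ → ℝ} {k : ℕ} (hk : 1 ≤ k) {c : ℝ} (h : ∀ j, 1 ≤ j → c ≤ g j) :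
    c ≤ minUpTo g k := by
  obtain ⟨j, hj, he⟩ := (isLeast_minUpTo g hk).1
  exact he ▸ h j hj.1

theorem minUpTo_mono {g h : ℕ → ℝ} (hgh : ∀ j, 1 ≤ j → g j ≤ h j) {k : ℕ} (hk : 1 ≤ k) :
    minUpTo g k ≤ minUpTo h k := by
  obtain ⟨j, hj, he⟩ := (isLeast_minUpTo h hk).1
  exact he ▸ (minUpTo_le g hj.1 hj.2).trans (hgh j hj.1)

theorem mul_minUpTo_sq_le_sum {g : ℕ → ℝ} (hg : ∀ j, 1 ≤ j → 0 ≤ g j) {k : ℕ} (hk : 1 ≤ k) :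
    k * minUpTo g k ^ 2 ≤ ∑ j ∈ Finset.range k, g (j + 1) ^ 2 := by
  have h := Finset.card_nsmul_le_sum (Finset.range k) (fun j => g (j + 1) ^ 2) (minUpTo g k ^ 2)
    fun j hj => pow_le_pow_left₀ (le_minUpTo hk hg)
      (minUpTo_le g (by omega) (by have := Finset.mem_range.1 hj; omega)) 2
  simpa using h

end TGVMin

theorem theorem5 {T α β : ℝ} (hT : 0 < T) (hα : 0 < α) (hβ : 0 < β)
    (f : TGVMin.L2 T → ℝ)
    -- A1: `f` is continuously Fréchet differentiable
    (hA1 : ContDiff ℝ 1 f)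
    -- A2: `∇f` is Lipschitz continuous
    {Lf : ℝ} (hLf : 0 < Lf)
    (hA2 : ∀ u₁ u₂ : TGVMin.L2 T, ‖gradient f u₁ - gradient f u₂‖ ≤ Lf * ‖u₁ - u₂‖)
    -- A3: `f` is bounded from below
    {Cf : ℝ} (hCf : 0 < Cf) (hA3 : ∀ u, -Cf ≤ f u)
    -- A4: the sublevel sets of `J` are bounded in `BV(0,T)`
    (hA4 : ∀ b : ℝ, ∃ r : NNReal, ∀ u ∈ TGVMin.BV T,
      TGVMin.J T α β f u ≤ b → TGVMin.bvNorm T u ≤ r)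
    (R : TGVMin.Run T α β f)
    {C : ℝ} (hC : 0 < C)
    (hbound : ∀ k, 1 ≤ k → max ‖R.u k‖ ((f 0 + Cf) * ‖R.uhat k‖) ≤ C) :
    (∀ k : ℕ, 1 ≤ k →
      TGVMin.minUpTo (R.Psi (f 0 + Cf)) k + TGVMin.minUpTo R.gap k
        ≤ √(8 * Lf * C ^ 2 * R.residual 1 / k)) ∧
    (fun k : ℕ => TGVMin.minUpTo (R.Psi (f 0 + Cf)) k + TGVMin.minUpTo R.gap k)
      =O[Filter.atTop] (fun k : ℕ => (k : ℝ) ^ (-(1 / 2) : ℝ)) := by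
  have hf : Differentiable ℝ f := hA1.differentiable (by simp)
  have hM : 0 ≤ f 0 + Cf := by linarith [hA3 0]
  have hPsi : ∀ j, 1 ≤ j → 0 ≤ R.Psi (f 0 + Cf) j := fun j hj =>
    (abs_nonneg _).trans (TGVMin.Run.gap_le_Psi hT hα hβ hf hA3 hj)
  have hbd : ∀ k, 1 ≤ k → (f 0 + Cf) * ‖R.uhat k‖ ≤ C := fun k hk =>
    (le_max_right _ _).trans (hbound k hk)
  have main : ∀ k : ℕ, 1 ≤ k →
      TGVMin.minUpTo (R.Psi (f 0 + Cf)) k + TGVMin.minUpTo R.gap k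
        ≤ √(8 * Lf * C ^ 2 * R.residual 1 / k) := by
    intro k hk
    have hk0 : (0 : ℝ) < k := by exact_mod_cast hk
    have h1 := TGVMin.minUpTo_mono
      (fun j hj => TGVMin.Run.gap_le_Psi (R := R) hT hα hβ hf hA3 hj) hk
    have h2 := (TGVMin.mul_minUpTo_sq_le_sum hPsi hk).trans
      (TGVMin.Run.sum_Psi_sq_le hT hα hβ hf hLf hA2 hA3 hC hbd k)
    -- The gap minimum is replaced by the violation minimum m; then (2m)² = 4m² turns the constant 2
    -- into 8.
    refine (add_le_add_right h1 _).trans (Real.le_sqrt_of_sq_le ?_)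
    rw [le_div_iff₀ hk0]
    linarith
  refine ⟨main, Asymptotics.IsBigO.of_bound √(8 * Lf * C ^ 2 * R.residual 1) ?_⟩
  filter_upwards [Filter.eventually_ge_atTop 1] with k hk
  have hk0 : (0 : ℝ) ≤ k := Nat.cast_nonneg k
  have h0 : 0 ≤ TGVMin.minUpTo (R.Psi (f 0 + Cf)) k + TGVMin.minUpTo R.gap k :=
    add_nonneg (TGVMin.le_minUpTo hk hPsi) (TGVMin.le_minUpTo hk fun j _ => abs_nonneg _)
  rw [Real.norm_of_nonneg h0, Real.norm_of_nonneg (Real.rpow_nonneg hk0 _), Real.rpow_neg hk0,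
    ← Real.sqrt_eq_rpow, ← div_eq_mul_inv, ← Real.sqrt_div' _ hk0]
  exact main k hk
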